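/- **Theorem (Almost linear convergence rate, generalized MaxEnt).** Throughout, $\log$ is the logarithm to base $2$, $\ln$ the natural one, and $\|\cdot\|_2$ the Euclidean norm. Let $K\subset\mathbb R$ be compact, let $\mathcal P(K)$ be the set of Borel probability measures on $K$, let $\nu\in\mathcal P(K)$, $y\in\mathbb R^M$, and let $U_1,\dots,U_M\subset\mathbb R$ be compact convex sets containing $0$. Put $T:=\prod_{i=1}^M\{y_i-u : u\in U_i\}\subset\mathbb R^M$, and $(\mathcal A\mu)_i:=\int_K x^i\,\mu(dx)$ for $i=1,\dots,M$ and a finite signed measure $\mu$ on $K$, with norm $\|\mathcal A\|:=\sup\{\langle\mathcal A\mu,v\rangle : \|\mu\|_{\mathrm{TV}}=1,\ \|v\|_2=1\}$ (where $\|\mu\|_{\mathrm{TV}}=|\mu|(K)$), and $\mathcal A^*z(x):=\sum_{i=1}^M z_ix^i$. Let $D(\mu\|\nu):=\int\log\frac{d\mu}{d\nu}\,d\mu$ if $\mu\ll\nu$ and $+\infty$ otherwise, and $$J^\star:=\min_{\mu\in\mathcal P(K)}\{D(\mu\|\nu) : \mathcal A\mu\in T\},\qquad F(z):=-\max_{x\in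 T}\langle x,z\rangle+\min_{\mu\in\mathcal P(K)}\{D(\mu\|\nu)+\langle\mathcal A\mu,z\rangle\}\quad(z\in\mathbb R^M).$$ For $\eta=(\eta_1,\eta_2)\in\mathbb R_{>0}^2$ let $$F_\eta(z):=-\max_{x\in T}\Big\{\langle x,z\rangle-\tfrac{\eta_1}{2}\|x\|_2^2\Big\}+\min_{\mu\in\mathcal P(K)}\{D(\mu\|\nu)+\langle\mathcal A\mu,z\rangle\}-\tfrac{\eta_2}{2}\|z\|_2^2,\qquad L(\eta):=\tfrac1{\eta_1}+\|\mathcal A\|^2+\eta_2 ,$$ and consider the fast gradient method started at $w_0=y_0\in\mathbb R^M$: for $k\ge 0$, $$y_{k+1}=w_k+\tfrac1{L(\eta)}\nabla F_\eta(w_k),\qquad w_{k+1}=y_{k+1}+\tfrac{\sqrt{L(\eta)}-\sqrt{\eta_2}}{\sqrt{L(\eta)}+\sqrt{\eta_2}}\,(y_{k+1}-y_k).$$ Assume that there is a Slater point: $\mu_0\in\mathcal P(K)$ with $\mathcal A\mu_0\in T$, $\delta:=\inf_{x\in T^c}\|\mathcal A\mu_0-x\|_2>0$ and $0<C:=D(\mu_0\|\nu)<\infty$.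 Put $D:=\frac12\max_{x\in T}\|x\|_2^2$ and, for $\varepsilon>0$, $\eta_1(\varepsilon):=\frac{\varepsilon}{4D}$, $\eta_2(\varepsilon):=\frac{\varepsilon\delta^2}{2C^2}$, $\kappa(\varepsilon):=\frac{8DC^2}{\varepsilon^2\delta^2}+\frac{2\|\mathcal A\|^2C^2}{\varepsilon\delta^2}+1$, $$N_1(\varepsilon):=2\sqrt{\kappa(\varepsilon)}\,\ln\frac{10(\varepsilon+2C)}{\varepsilon},\qquad N_2(\varepsilon):=2\sqrt{\kappa(\varepsilon)}\,\ln\left(\frac{C}{\varepsilon\delta(2-\sqrt3)}\sqrt{4\Big(\frac{4D}{\varepsilon}+\|\mathcal A\|^2+\frac{\varepsilon\delta^2}{2C^2}\Big)\Big(C+\frac\varepsilon2\Big)}\right),$$ and $N(\varepsilon):=\lceil\max\{N_1(\varepsilon),N_2(\varepsilon)\}\rceil$. Then for every $\varepsilon>0$, with $\eta=(\eta_1(\varepsilon),\eta_2(\varepsilon))$ and any starting point $y_0$ with $F_\eta(y_0)\ge F_\eta(0)$ (for instance $y_0=0$), the iterate $\hat z:=y_{N(\varepsilon)}$ obtained after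 $N(\varepsilon)$ iterations and the probability measure $\hat\mu(B):=\int_B2^{-\mathcal A^*\hat z(x)}\nu(dx)\big/\int_K2^{-\mathcal A^*\hat z(x)}\nu(dx)$ satisfy $D(\hat\mu\|\nu)<\infty$ and * dual $\varepsilon$-optimality: $0\le J^\star-F(\hat z)\le\varepsilon$; * primal $\varepsilon$-optimality: $|D(\hat\mu\|\nu)-J^\star|\le 2(1+2\sqrt3)\,\varepsilon$; * primal $\varepsilon$-feasibility: $d(\mathcal A\hat\mu,T):=\min_{x\in T}\|\mathcal A\hat\mu-x\|_2\le\frac{2\varepsilon\delta}{C}$. Moreover, $N(\varepsilon)=O\big(\varepsilon^{-1}\log(1/\varepsilon)\big)$ as $\varepsilon\downarrow0$, all other data being fixed. -/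

import Mathlib

open MeasureTheory Filter Topology Asymptotics
open scoped ENNReal

namespace MaxEnt

noncomputable section

/-- Relative entropy in bits (logarithm to base `2`), with value `∞` unless `μ ≪ ν`. Mathlib's
`klDiv` is the natural-logarithm version. -/
def relEnt {α : Type*} [MeasurableSpace α] (μ ν : Measure α) : ℝ≥0∞ :=
  InformationTheory.klDiv μ ν / ENNReal.ofReal (Real.log 2)

variable {K : Set ℝ} {M : ℕ}

/-- The moment operator `(𝒜 μ)_i = ∫ x ^ i dμ`, `i = 1, …, M`, on (positive) measures on `K`. -/
def moments (M : ℕ) (μ : Measure K) : EuclideanSpace ℝ (Fin M) :=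
  WithLp.toLp 2 fun i => ∫ x : K, (x : ℝ) ^ ((i : ℕ) + 1) ∂μ

/-- The moment operator on finite signed measures, through the Jordan decomposition. -/
def signedMoments (M : ℕ) (s : SignedMeasure K) : EuclideanSpace ℝ (Fin M) :=
  moments M s.toJordanDecomposition.posPart - moments M s.toJordanDecomposition.negPart

/-- The operator norm of `𝒜` with respect to the total variation norm (total mass of the
variation) on signed measures and the Euclidean norm. -/
def momentNorm (K : Set ℝ) (M : ℕ) : ℝ :=
  sSup {r : ℝ | ∃ (s : SignedMeasure K) (v : EuclideanSpace ℝ (Fin M)),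
    s.totalVariation Set.univ = 1 ∧ ‖v‖ = 1 ∧ r = inner ℝ (signedMoments M s) v}

/-- The adjoint operator `(𝒜* z)(x) = ∑ z_i x ^ i`, `i = 1, …, M`. -/
def adjointMoments (z : EuclideanSpace ℝ (Fin M)) (x : ℝ) : ℝ :=
  ∑ i : Fin M, z i * x ^ ((i : ℕ) + 1)

/-- The set `T = ∏ {y_i - u : u ∈ U_i}`. -/
def constraintSet (y : Fin M → ℝ) (U : Fin M → Set ℝ) : Set (EuclideanSpace ℝ (Fin M)) :=
  {t | ∀ i, ∃ u ∈ U i, t i = y i - u}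

/-- The optimal value `J*` of the relative entropy minimization over `P(K)` subject to
`𝒜 μ ∈ T`. -/
def primalValue (ν : ProbabilityMeasure K) (T : Set (EuclideanSpace ℝ (Fin M))) : ℝ≥0∞ :=
  ⨅ μ : ProbabilityMeasure K, ⨅ _ : moments M (μ : Measure K) ∈ T, relEnt (μ : Measure K) ν

/-- The value `min_{μ ∈ P(K)} {D(μ‖ν) + ⟨𝒜 μ, z⟩}`. The infimum is taken in the extended reals,
where it is finite for compact `K`. -/
def entropyTerm (ν : ProbabilityMeasure K) (z : EuclideanSpace ℝ (Fin M)) : ℝ :=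
  (⨅ μ : ProbabilityMeasure K, ((relEnt (μ : Measure K) ν : ℝ≥0∞) : EReal) +
    ((inner ℝ (moments M (μ : Measure K)) z : ℝ) : EReal)).toReal

/-- The support function of `T`. -/
def supportFn (T : Set (EuclideanSpace ℝ (Fin M))) (z : EuclideanSpace ℝ (Fin M)) : ℝ :=
  sSup ((fun x => inner ℝ x z) '' T)

/-- The dual function `F`. -/
def dualFn (ν : ProbabilityMeasure K) (T : Set (EuclideanSpace ℝ (Fin M)))
    (z : EuclideanSpace ℝ (Fin M)) : ℝ :=
  -supportFn T z + entropyTerm ν z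

/-- The doubly smoothed dual function `F_η`, `η = (η₁, η₂)`. -/
def smoothedDualFn (ν : ProbabilityMeasure K) (T : Set (EuclideanSpace ℝ (Fin M))) (η₁ η₂ : ℝ)
    (z : EuclideanSpace ℝ (Fin M)) : ℝ :=
  -sSup ((fun x => inner ℝ x z - η₁ / 2 * ‖x‖ ^ 2) '' T) + entropyTerm ν z - η₂ / 2 * ‖z‖ ^ 2

/-- The constant `L(η) = 1 / η₁ + ‖𝒜‖² + η₂`. -/
def lipConst (K : Set ℝ) (M : ℕ) (η₁ η₂ : ℝ) : ℝ :=
  1 / η₁ + momentNorm K M ^ 2 + η₂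

/-- The pair `(y_k, w_k)` after `k` iterations of the fast gradient method for maximizing
`F_η`, started at `y₀ = w₀`. -/
def fastGradient (ν : ProbabilityMeasure K) (T : Set (EuclideanSpace ℝ (Fin M))) (η₁ η₂ : ℝ)
    (y₀ : EuclideanSpace ℝ (Fin M)) :
    ℕ → EuclideanSpace ℝ (Fin M) × EuclideanSpace ℝ (Fin M)
  | 0 => (y₀, y₀)
  | k + 1 =>
    let L := lipConst K M η₁ η₂
    let y := (fastGradient ν T η₁ η₂ y₀ k).1
    let w := (fastGradient ν T η₁ η₂ y₀ k).2
    let y' := w + (1 / L) • gradient (smoothedDualFn ν T η₁ η₂) w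
    (y', y' + ((√L - √η₂) / (√L + √η₂)) • (y' - y))

/-- The Gibbs measure with density proportional to `2 ^ (-(𝒜* z)(x))` with respect to `ν`. -/
def gibbs (ν : ProbabilityMeasure K) (z : EuclideanSpace ℝ (Fin M)) : Measure K :=
  (∫⁻ x : K, ENNReal.ofReal ((2 : ℝ) ^ (-adjointMoments z x)) ∂(ν : Measure K))⁻¹ •
    (ν : Measure K).withDensity fun x => ENNReal.ofReal ((2 : ℝ) ^ (-adjointMoments z x))

/-- The constant `C = D(μ₀‖ν)`. -/
def constC (ν μ₀ : ProbabilityMeasure K) : ℝ :=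
  (relEnt (μ₀ : Measure K) ν).toReal

/-- The constant `D = (1 / 2) max_{x ∈ T} ‖x‖²`. -/
def constD (T : Set (EuclideanSpace ℝ (Fin M))) : ℝ :=
  1 / 2 * sSup ((fun x => ‖x‖ ^ 2) '' T)

/-- The distance `δ` of `𝒜 μ₀` to the complement of `T`. -/
def constδ (T : Set (EuclideanSpace ℝ (Fin M))) (μ₀ : ProbabilityMeasure K) : ℝ :=
  Metric.infDist (moments M (μ₀ : Measure K)) Tᶜ

/-- `N₁(ε)`, where `a` stands for `‖𝒜‖`. -/
def iter₁ (C D δ a ε : ℝ) : ℝ :=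
  2 * √(8 * D * C ^ 2 / (ε ^ 2 * δ ^ 2) + 2 * a ^ 2 * C ^ 2 / (ε * δ ^ 2) + 1) *
    Real.log (10 * (ε + 2 * C) / ε)

/-- `N₂(ε)`, where `a` stands for `‖𝒜‖`. -/
def iter₂ (C D δ a ε : ℝ) : ℝ :=
  2 * √(8 * D * C ^ 2 / (ε ^ 2 * δ ^ 2) + 2 * a ^ 2 * C ^ 2 / (ε * δ ^ 2) + 1) *
    Real.log (C / (ε * δ * (2 - √3)) *
      √(4 * (4 * D / ε + a ^ 2 + ε * δ ^ 2 / (2 * C ^ 2)) * (C + ε / 2)))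

/-- `N(ε) = ⌈max {N₁(ε), N₂(ε)}⌉`. -/
def numIter (C D δ a ε : ℝ) : ℕ :=
  ⌈max (iter₁ C D δ a ε) (iter₂ C D δ a ε)⌉₊

end

end MaxEnt

/-!
The relative entropy and the moment operator enter the dual problem only through the binary
log-partition function, so that `-F_η` is the sum of the regularized support function of `T`, this
log-partition function and `η₂ / 2 * ‖z‖ ^ 2`. The first summand is `1 / η₁`-smooth because the
concave problem defining it has a unique, stable maximizer; the second is `‖𝒜‖ ^ 2`-smooth because
its gradient is minus the moment vector of the Gibbs measure and Hoeffding's lemma controls its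
second-order remainder. Hence `-F_η` is `η₂`-strongly convex and `L(η)`-smooth, and Nesterov's
potential shows that the fast gradient method shrinks the gap by `1 - √(η₂ / L(η))` per step.

The Slater point forces every maximizer `p` of `F` to satisfy `‖p‖ ≤ C / δ`, which bounds the cost
of the smoothing at `p`. The gradient of `F_η` at `z` is `𝒜 μ̂ - x - η₂ z`, where `μ̂` is the Gibbs
measure and `x ∈ T` the regularized maximizer: when it is small, `𝒜 μ̂` is close to `T` and
complementary slackness nearly holds, which brings `D(μ̂‖ν)` close to `F(z)`.
-/

namespace MaxEnt

open scoped InnerProductSpace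

section Optimization

variable {E : Type*} [NormedAddCommGroup E] [InnerProductSpace ℝ E]

/-- `f` has gradient field `g` and curvature between `m` and `L`: at every point it lies between
two quadratic models. For `0 ≤ m` this says that `f` is `m`-strongly convex and `L`-smooth; stating
it without derivatives makes it stable under sums, negation and rescaling. -/
def HasQuadraticBounds (f : E → ℝ) (g : E → E) (m L : ℝ) : Prop :=
  ∀ x d, f x + ⟪g x, d⟫_ℝ + m / 2 * ‖d‖ ^ 2 ≤ f (x + d) ∧
    f (x + d) ≤ f x + ⟪g x, d⟫_ℝ + L / 2 * ‖d‖ ^ 2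

theorem hasQuadraticBounds_norm_sq (c : ℝ) :
    HasQuadraticBounds (fun x : E => c / 2 * ‖x‖ ^ 2) (fun x => c • x) c c := by
  intro x d
  simp only [norm_add_sq_real, real_inner_smul_left]
  constructor <;> linarith

theorem norm_sq_convexCombination_le {s : ℝ} (hs₀ : 0 ≤ s) (hs₁ : s ≤ 1) (a b : E) :
    ‖(1 - s) • a + s • b‖ ^ 2 ≤ (1 - s) * ‖a‖ ^ 2 + s * ‖b‖ ^ 2 :=
  ((convexOn_univ_norm (E := E)).pow (fun _ _ => norm_nonneg _) 2).2 trivial trivial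
    (sub_nonneg.2 hs₁) hs₀ (sub_add_cancel 1 s)

namespace HasQuadraticBounds

variable {f f₁ f₂ : E → ℝ} {g g₁ g₂ : E → E} {m m₁ m₂ L L₁ L₂ s : ℝ}

theorem add (h₁ : HasQuadraticBounds f₁ g₁ m₁ L₁) (h₂ : HasQuadraticBounds f₂ g₂ m₂ L₂) :
    HasQuadraticBounds (fun x => f₁ x + f₂ x) (fun x => g₁ x + g₂ x) (m₁ + m₂) (L₁ + L₂) := by
  intro x d
  obtain ⟨hl₁, hu₁⟩ := h₁ x d
  obtain ⟨hl₂, hu₂⟩ := h₂ x d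
  rw [inner_add_left]
  constructor <;> linarith

theorem neg (h : HasQuadraticBounds f g m L) :
    HasQuadraticBounds (fun x => -f x) (fun x => -g x) (-L) (-m) := by
  intro x d
  obtain ⟨hl, hu⟩ := h x d
  rw [inner_neg_left]
  constructor <;> linarith

theorem const_mul (h : HasQuadraticBounds f g m L) {a : ℝ} (ha : 0 ≤ a) :
    HasQuadraticBounds (fun x => a * f x) (fun x => a • g x) (a * m) (a * L) := by
  intro x d
  obtain ⟨hl, hu⟩ := h x d
  rw [real_inner_smul_left]
  constructor
  · linarith [mul_le_mul_of_nonneg_left hl ha]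
  · linarith [mul_le_mul_of_nonneg_left hu ha]

theorem comp_smul (h : HasQuadraticBounds f g m L) (c : ℝ) :
    HasQuadraticBounds (fun x => f (c • x)) (fun x => c • g (c • x)) (c ^ 2 * m) (c ^ 2 * L) := by
  intro x d
  obtain ⟨hl, hu⟩ := h (c • x) (c • d)
  rw [real_inner_smul_right, norm_smul, mul_pow, Real.norm_eq_abs, sq_abs, ← smul_add] at hl hu
  rw [real_inner_smul_left]
  constructor <;> linarith

theorem mono_right (h : HasQuadraticBounds f g m L₁) (hL : L₁ ≤ L₂) :
    HasQuadraticBounds f g m L₂ :=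
  fun x d => ⟨(h x d).1, (h x d).2.trans (by gcongr)⟩

theorem hasGradientAt [CompleteSpace E] (h : HasQuadraticBounds f g m L) (x : E) :
    HasGradientAt f (g x) x := by
  rw [hasGradientAt_iff_isLittleO_nhds_zero]
  have remainder_isBigO : (fun d => f (x + d) - f x - ⟪g x, d⟫_ℝ) =O[𝓝 0] fun d : E => ‖d‖ ^ 2 := by
    refine IsBigO.of_bound (|m / 2| + |L / 2|) (Eventually.of_forall fun d => ?_)
    obtain ⟨hl, hu⟩ := h x d
    rw [Real.norm_eq_abs, norm_pow, norm_norm, abs_le]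
    constructor
    · nlinarith [neg_abs_le (m / 2), abs_nonneg (L / 2), sq_nonneg ‖d‖]
    · nlinarith [le_abs_self (L / 2), abs_nonneg (m / 2), sq_nonneg ‖d‖]
  exact remainder_isBigO.trans_isLittleO (isLittleO_norm_pow_id one_lt_two)

theorem continuous [CompleteSpace E] (h : HasQuadraticBounds f g m L) : Continuous f :=
  continuous_iff_continuousAt.2 fun x => (h.hasGradientAt x).continuousAt

theorem apply_sub_le (h : HasQuadraticBounds f g m L) (hL : 0 < L) (x : E) :
    f (x - (1 / L) • g x) ≤ f x - ‖g x‖ ^ 2 / (2 * L) := by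
  have hu := (h x (-((1 / L) • g x))).2
  rw [← sub_eq_add_neg, inner_neg_right, real_inner_smul_right, norm_neg, norm_smul,
    real_inner_self_eq_norm_sq, mul_pow, Real.norm_eq_abs, sq_abs] at hu
  refine hu.trans_eq ?_
  field_simp
  ring

theorem norm_gradient_sq_le (h : HasQuadraticBounds f g m L) (hL : 0 < L) {γ : ℝ} {x : E}
    (hx : ∀ v, f x - f v ≤ γ) : ‖g x‖ ^ 2 ≤ 2 * L * γ := by
  have hdescent : ‖g x‖ ^ 2 / (2 * L) ≤ γ := by
    linarith [h.apply_sub_le hL x, hx (x - (1 / L) • g x)]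
  rwa [div_le_iff₀' (by positivity)] at hdescent

theorem exists_forall_le [FiniteDimensional ℝ E] (h : HasQuadraticBounds f g m L) (hm : 0 < m) :
    ∃ p, ∀ x, f p ≤ f x := by
  have := FiniteDimensional.complete ℝ E
  refine h.continuous.exists_forall_le (tendsto_atTop_mono (f := fun x => f 0 +
    ‖x‖ * (-‖g 0‖ + m / 2 * ‖x‖)) (fun x => ?_) (tendsto_atTop_add_const_left _ _ ?_))
  · have hlower := (h 0 x).1
    have := (abs_le.1 (abs_real_inner_le_norm (g 0) x)).1
    rw [zero_add] at hlower
    linarith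
  · have hnorm := tendsto_norm_cocompact_atTop (E := E)
    exact hnorm.atTop_mul_atTop₀
      (tendsto_atTop_add_const_left _ _ (hnorm.const_mul_atTop (half_pos hm)))

theorem gradient_eq_zero [CompleteSpace E] (h : HasQuadraticBounds f g m L) {p : E}
    (hp : ∀ x, f p ≤ f x) : g p = 0 := by
  have hmin : IsLocalMin f p := Eventually.of_forall hp
  simpa using hmin.hasFDerivAt_eq_zero (h.hasGradientAt p).hasFDerivAt

theorem norm_sub_sq_le [CompleteSpace E] (h : HasQuadraticBounds f g m L) {p : E}
    (hp : ∀ x, f p ≤ f x) (x : E) : m / 2 * ‖x - p‖ ^ 2 ≤ f x - f p := by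
  have hl := (h p (x - p)).1
  rw [h.gradient_eq_zero hp, inner_zero_left, add_sub_cancel] at hl
  linarith

theorem le_add_inner_of_isMinOn (hf : HasQuadraticBounds f g m L) {T : Set E} {h : E → ℝ}
    (hh : ConvexOn ℝ T h) {p x : E}
    (hp : IsMinOn (fun x => h x + f x) T p) (hpT : p ∈ T) (hx : x ∈ T) :
    h p ≤ h x + ⟪g p, x - p⟫_ℝ := by
  have hsegment : ∀ t ∈ Set.Ioc (0 : ℝ) 1,
      h p ≤ h x + ⟪g p, x - p⟫_ℝ + t * (L / 2 * ‖x - p‖ ^ 2) := by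
    rintro t ⟨ht₀, ht₁⟩
    have hmem := hh.1.add_smul_sub_mem hpT hx ⟨ht₀.le, ht₁⟩
    have hmin : h p + f p ≤ h (p + t • (x - p)) + f (p + t • (x - p)) := hp hmem
    have hconvex : h (p + t • (x - p)) ≤ (1 - t) * h p + t * h x := by
      rw [show p + t • (x - p) = (1 - t) • p + t • x by module]
      exact hh.2 hpT hx (sub_nonneg.2 ht₁) ht₀.le (sub_add_cancel 1 t)
    have hmodel := (hf p (t • (x - p))).2
    rw [real_inner_smul_right, norm_smul, mul_pow, Real.norm_eq_abs, sq_abs] at hmodel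
    refine le_of_mul_le_mul_left ?_ ht₀
    linarith
  have hlimit : Tendsto (fun t => h x + ⟪g p, x - p⟫_ℝ + t * (L / 2 * ‖x - p‖ ^ 2)) (𝓝[>] 0)
      (𝓝 (h x + ⟪g p, x - p⟫_ℝ + 0 * (L / 2 * ‖x - p‖ ^ 2))) :=
    (Continuous.tendsto (by fun_prop) 0).mono_left nhdsWithin_le_nhds
  rw [zero_mul, add_zero] at hlimit
  exact ge_of_tendsto hlimit (mem_of_superset (Ioc_mem_nhdsGT one_pos) hsegment)

/-- Nesterov's potential `f y - f x + m / 2 * ‖v - x‖ ^ 2` with `v = w + s⁻¹ • (w - y)` contracts by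
the factor `1 - s`, where `m = s ^ 2 * L`. The point `y + s⁻¹ • (y' - y)` on the left-hand side is
the next `v`, see `extrapolate_momentum`. -/
theorem potential_step (h : HasQuadraticBounds f g (s ^ 2 * L) L) (hL : 0 < L) (hs₀ : 0 < s)
    (hs₁ : s ≤ 1) (x y w : E) :
    f (w - (1 / L) • g w) - f x +
        s ^ 2 * L / 2 * ‖y + s⁻¹ • (w - (1 / L) • g w - y) - x‖ ^ 2 ≤
      (1 - s) * (f y - f x + s ^ 2 * L / 2 * ‖w + s⁻¹ • (w - y) - x‖ ^ 2) := by
  set c := (1 - s) • (w + s⁻¹ • (w - y) - x) + s • (w - x) with hc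
  have hcombination : y + s⁻¹ • (w - (1 / L) • g w - y) - x = c - (s * L)⁻¹ • g w := by
    rw [hc]
    match_scalars <;> field_simp <;> ring
  have hinner : s * ⟪g w, c⟫_ℝ = -(s * ⟪g w, x - w⟫_ℝ) - (1 - s) * ⟪g w, y - w⟫_ℝ := by
    have : s • c = -(s • (x - w)) - (1 - s) • (y - w) := by
      rw [hc]
      match_scalars <;> field_simp <;> ring
    simpa only [inner_sub_right, inner_neg_right, real_inner_smul_right] using
      congrArg (inner ℝ (g w)) this
  have hexpand : s ^ 2 * L / 2 * ‖c - (s * L)⁻¹ • g w‖ ^ 2 =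
      s ^ 2 * L / 2 * ‖c‖ ^ 2 - s * ⟪g w, c⟫_ℝ + ‖g w‖ ^ 2 / (2 * L) := by
    rw [norm_sub_sq_real, real_inner_smul_right, real_inner_comm, norm_smul, mul_pow,
      Real.norm_eq_abs, sq_abs]
    field_simp
  have hconvex : s ^ 2 * L / 2 * ‖c‖ ^ 2 ≤
      s ^ 2 * L / 2 * ((1 - s) * ‖w + s⁻¹ • (w - y) - x‖ ^ 2 + s * ‖w - x‖ ^ 2) := by
    gcongr
    exact norm_sq_convexCombination_le hs₀.le hs₁ _ _
  have hdescent := h.apply_sub_le hL w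
  have hmodel_x : s * (f w + ⟪g w, x - w⟫_ℝ + s ^ 2 * L / 2 * ‖w - x‖ ^ 2) ≤ s * f x := by
    have := (h w (x - w)).1
    rw [add_sub_cancel, norm_sub_rev] at this
    gcongr
  have hmodel_y : (1 - s) * (f w + ⟪g w, y - w⟫_ℝ) ≤ (1 - s) * f y := by
    have := (h w (y - w)).1
    rw [add_sub_cancel] at this
    have : 0 ≤ s ^ 2 * L / 2 * ‖y - w‖ ^ 2 := by positivity
    gcongr
    linarith
  rw [hcombination, hexpand]
  linarith

theorem extrapolate_momentum (hs : 0 < s) (y y' : E) :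
    y' + ((1 - s) / (1 + s)) • (y' - y) +
        s⁻¹ • (y' + ((1 - s) / (1 + s)) • (y' - y) - y') = y + s⁻¹ • (y' - y) := by
  match_scalars <;> field_simp <;> ring

theorem potential_le (h : HasQuadraticBounds f g (s ^ 2 * L) L) (hL : 0 < L) (hs₀ : 0 < s)
    (hs₁ : s ≤ 1) {y w : ℕ → E} (h₀ : w 0 = y 0) (hy : ∀ k, y (k + 1) = w k - (1 / L) • g (w k))
    (hw : ∀ k, w (k + 1) = y (k + 1) + ((1 - s) / (1 + s)) • (y (k + 1) - y k)) (x : E) (k : ℕ) :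
    f (y k) - f x + s ^ 2 * L / 2 * ‖w k + s⁻¹ • (w k - y k) - x‖ ^ 2 ≤
      (1 - s) ^ k * (f (y 0) - f x + s ^ 2 * L / 2 * ‖y 0 - x‖ ^ 2) := by
  induction k with
  | zero => simp [h₀]
  | succ k ih =>
    rw [hw, extrapolate_momentum hs₀, hy, pow_succ' (1 - s), mul_assoc]
    exact (h.potential_step hL hs₀ hs₁ x (y k) (w k)).trans
      (mul_le_mul_of_nonneg_left ih (sub_nonneg.2 hs₁))

theorem fast_gradient_rate [CompleteSpace E] (h : HasQuadraticBounds f g m L) (hm : 0 < m)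
    (hmL : m ≤ L) {p : E} (hp : ∀ x, f p ≤ f x) {y w : ℕ → E} (h₀ : w 0 = y 0)
    (hy : ∀ k, y (k + 1) = w k - (1 / L) • g (w k))
    (hw : ∀ k, w (k + 1) = y (k + 1) + ((√L - √m) / (√L + √m)) • (y (k + 1) - y k)) (k : ℕ) :
    f (y k) - f p ≤ (1 - √(m / L)) ^ k * (2 * (f (y 0) - f p)) := by
  have hL : 0 < L := hm.trans_le hmL
  have hs₀ : 0 < √(m / L) := Real.sqrt_pos.2 (div_pos hm hL)
  have hs₁ : √(m / L) ≤ 1 := Real.sqrt_le_one.2 ((div_le_one hL).2 hmL)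
  have hm_eq : √(m / L) ^ 2 * L = m := by
    rw [Real.sq_sqrt (by positivity), div_mul_cancel₀ _ hL.ne']
  have hmomentum : (√L - √m) / (√L + √m) = (1 - √(m / L)) / (1 + √(m / L)) := by
    rw [Real.sqrt_div hm.le]
    field_simp
  have hpotential := (hm_eq.symm ▸ h).potential_le hL hs₀ hs₁ h₀ hy (hmomentum ▸ hw) p k
  rw [hm_eq] at hpotential
  calc f (y k) - f p
      ≤ f (y k) - f p + m / 2 * ‖w k + (√(m / L))⁻¹ • (w k - y k) - p‖ ^ 2 :=
        le_add_of_nonneg_right (by positivity)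
    _ ≤ (1 - √(m / L)) ^ k * (f (y 0) - f p + m / 2 * ‖y 0 - p‖ ^ 2) := hpotential
    _ ≤ (1 - √(m / L)) ^ k * (2 * (f (y 0) - f p)) := by
        have := h.norm_sub_sq_le hp (y 0)
        have := sub_nonneg.2 hs₁
        gcongr
        linarith

theorem fast_gradient_gap_le [CompleteSpace E] (h : HasQuadraticBounds f g m L) (hm : 0 < m)
    (hmL : m ≤ L) {p : E} (hp : ∀ x, f p ≤ f x) {y w : ℕ → E} (h₀ : w 0 = y 0)
    (hy : ∀ k, y (k + 1) = w k - (1 / L) • g (w k))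
    (hw : ∀ k, w (k + 1) = y (k + 1) + ((√L - √m) / (√L + √m)) • (y (k + 1) - y k)) {A : ℝ}
    (hA : 0 < A) {k : ℕ} (hk : 2 * √(L / m) * Real.log A ≤ k) :
    f (y k) - f p ≤ 2 * (f (y 0) - f p) / A ^ 2 := by
  have hL : 0 < L := hm.trans_le hmL
  have hs : 0 < √(m / L) := Real.sqrt_pos.2 (div_pos hm hL)
  have hs₁ : √(m / L) ≤ 1 := Real.sqrt_le_one.2 ((div_le_one hL).2 hmL)
  have hexponent : 2 * Real.log A ≤ k * √(m / L) := by
    rw [← inv_div, Real.sqrt_inv] at hk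
    calc 2 * Real.log A = 2 * (√(m / L))⁻¹ * Real.log A * √(m / L) := by field_simp
      _ ≤ k * √(m / L) := by gcongr
  have hcontraction : (1 - √(m / L)) ^ k ≤ (A ^ 2)⁻¹ := calc
    (1 - √(m / L)) ^ k ≤ Real.exp (-√(m / L)) ^ k :=
      pow_le_pow_left₀ (sub_nonneg.2 hs₁) (Real.one_sub_le_exp_neg _) k
    _ = Real.exp (-(k * √(m / L))) := by rw [← Real.exp_nat_mul, mul_neg]
    _ ≤ Real.exp (-(2 * Real.log A)) := by gcongr
    _ = (A ^ 2)⁻¹ := by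
      rw [Real.exp_neg, mul_comm, Real.exp_mul, Real.exp_log hA, Real.rpow_two]
  have hgap : 0 ≤ f (y 0) - f p := sub_nonneg.2 (hp _)
  calc f (y k) - f p ≤ (1 - √(m / L)) ^ k * (2 * (f (y 0) - f p)) :=
        h.fast_gradient_rate hm hmL hp h₀ hy hw k
    _ ≤ (A ^ 2)⁻¹ * (2 * (f (y 0) - f p)) := by gcongr
    _ = 2 * (f (y 0) - f p) / A ^ 2 := by rw [div_eq_inv_mul]

end HasQuadraticBounds

end Optimization

section SupportFunction

variable {E : Type*} [NormedAddCommGroup E] [InnerProductSpace ℝ E] {T : Set E}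

/-- The convex conjugate of `η / 2 * ‖x‖ ^ 2` restricted to `T`. It smooths the support function of
`T`, which is the case `η = 0`. -/
noncomputable def regularizedSupport (T : Set E) (η : ℝ) (z : E) : ℝ :=
  sSup ((fun x => ⟪x, z⟫_ℝ - η / 2 * ‖x‖ ^ 2) '' T)

theorem exists_regularizedSupport_eq (hT : IsCompact T) (hne : T.Nonempty) (η : ℝ) (z : E) :
    ∃ p ∈ T, regularizedSupport T η z = ⟪p, z⟫_ℝ - η / 2 * ‖p‖ ^ 2 :=
  hT.exists_sSup_image_eq hne (by fun_prop)

theorem le_regularizedSupport (hT : IsCompact T) {x : E} (hx : x ∈ T) (η : ℝ) (z : E) :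
    ⟪x, z⟫_ℝ - η / 2 * ‖x‖ ^ 2 ≤ regularizedSupport T η z :=
  le_csSup (hT.image (by fun_prop)).bddAbove ⟨x, hx, rfl⟩

theorem inner_le_regularizedSupport_zero (hT : IsCompact T) {x : E} (hx : x ∈ T) (z : E) :
    ⟪x, z⟫_ℝ ≤ regularizedSupport T 0 z := by
  simpa using le_regularizedSupport hT hx 0 z

theorem regularizedSupport_le_add (hT : IsCompact T) (hne : T.Nonempty) {η η' r : ℝ}
    (hη : η ≤ η') (hr : ∀ x ∈ T, ‖x‖ ^ 2 ≤ r) (z : E) :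
    regularizedSupport T η z ≤ regularizedSupport T η' z + (η' - η) / 2 * r := by
  obtain ⟨p, hp, hp_eq⟩ := exists_regularizedSupport_eq hT hne η z
  have hle := le_regularizedSupport hT hp η' z
  have hnorm := mul_le_mul_of_nonneg_left (hr p hp) (sub_nonneg.2 hη)
  linarith

theorem regularizedSupport_anti (hT : IsCompact T) (hne : T.Nonempty) (z : E) :
    Antitone fun η => regularizedSupport T η z := by
  intro η η' hη
  obtain ⟨p, hp, hp_eq⟩ := exists_regularizedSupport_eq hT hne η' z
  calc regularizedSupport T η' z = ⟪p, z⟫_ℝ - η' / 2 * ‖p‖ ^ 2 := hp_eq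
    _ ≤ ⟪p, z⟫_ℝ - η / 2 * ‖p‖ ^ 2 := by gcongr
    _ ≤ regularizedSupport T η z := le_regularizedSupport hT hp η z

theorem convexOn_regularizedSupport (hT : IsCompact T) (hne : T.Nonempty) (η : ℝ) :
    ConvexOn ℝ Set.univ (regularizedSupport T η) := by
  refine ⟨convex_univ, fun z _ w _ a b ha hb hab => ?_⟩
  obtain ⟨p, hp, hp_eq⟩ := exists_regularizedSupport_eq hT hne η (a • z + b • w)
  calc regularizedSupport T η (a • z + b • w)
      = a * (⟪p, z⟫_ℝ - η / 2 * ‖p‖ ^ 2) + b * (⟪p, w⟫_ℝ - η / 2 * ‖p‖ ^ 2) := by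
        rw [hp_eq, inner_add_right, real_inner_smul_right, real_inner_smul_right]
        linear_combination (η / 2 * ‖p‖ ^ 2) * hab
    _ ≤ a * regularizedSupport T η z + b * regularizedSupport T η w := by
        gcongr <;> exact le_regularizedSupport hT hp η _

theorem continuous_regularizedSupport [FiniteDimensional ℝ E] (hT : IsCompact T)
    (hne : T.Nonempty) (η : ℝ) : Continuous (regularizedSupport T η) :=
  continuousOn_univ.1 ((convexOn_regularizedSupport hT hne η).continuousOn isOpen_univ)

theorem regularizedSupport_sub_le (hT : IsCompact T) (hconv : Convex ℝ T) {η : ℝ} {p x z : E}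
    (hp : p ∈ T) (hx : x ∈ T) (hp_eq : regularizedSupport T η z = ⟪p, z⟫_ℝ - η / 2 * ‖p‖ ^ 2) :
    ⟪x, z⟫_ℝ - η / 2 * ‖x‖ ^ 2 ≤ regularizedSupport T η z - η / 2 * ‖x - p‖ ^ 2 := by
  have hlinear : ConvexOn ℝ T fun x => -⟪x, z⟫_ℝ :=
    ⟨hconv, fun v _ w _ a b _ _ _ => by
      simp only [inner_add_left, real_inner_smul_left, smul_eq_mul]
      linarith⟩
  have hmin : IsMinOn (fun x => -⟪x, z⟫_ℝ + η / 2 * ‖x‖ ^ 2) T p := fun x hx => by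
    have := le_regularizedSupport hT hx η z
    rw [Set.mem_ofPred_eq]
    linarith
  have hvariational :=
    (hasQuadraticBounds_norm_sq (E := E) η).le_add_inner_of_isMinOn hlinear hmin hp hx
  rw [real_inner_smul_left, inner_sub_right, real_inner_self_eq_norm_sq] at hvariational
  rw [norm_sub_sq_real, real_inner_comm p x]
  linarith

theorem inner_sub_norm_sq_le {η : ℝ} (hη : 0 < η) (v d : E) :
    ⟪v, d⟫_ℝ - η / 2 * ‖v‖ ^ 2 ≤ 1 / η / 2 * ‖d‖ ^ 2 := by
  have hsq := sq_nonneg ‖d - η • v‖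
  rw [norm_sub_sq_real, real_inner_smul_right, norm_smul, mul_pow, Real.norm_eq_abs, sq_abs,
    real_inner_comm] at hsq
  have : 1 / η / 2 * ‖d‖ ^ 2 - (⟪v, d⟫_ℝ - η / 2 * ‖v‖ ^ 2) =
      1 / (2 * η) * (‖d‖ ^ 2 - 2 * (η * ⟪v, d⟫_ℝ) + η ^ 2 * ‖v‖ ^ 2) := by
    field_simp
    ring
  rw [← sub_nonneg, this]
  positivity

theorem hasQuadraticBounds_regularizedSupport (hT : IsCompact T) (hconv : Convex ℝ T) {η : ℝ}
    (hη : 0 < η) {p : E → E} (hpT : ∀ z, p z ∈ T)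
    (hp : ∀ z, regularizedSupport T η z = ⟪p z, z⟫_ℝ - η / 2 * ‖p z‖ ^ 2) :
    HasQuadraticBounds (regularizedSupport T η) p 0 (1 / η) := by
  intro z d
  constructor
  · have := le_regularizedSupport hT (hpT z) η (z + d)
    rw [inner_add_right] at this
    linarith [hp z]
  · have hgrowth := regularizedSupport_sub_le hT hconv (hpT z) (hpT (z + d)) (hp z)
    have hyoung := inner_sub_norm_sq_le hη (p (z + d) - p z) d
    rw [inner_sub_left] at hyoung
    rw [hp (z + d), inner_add_right]
    linarith

theorem inner_add_infDist_mul_norm_le (hT : IsCompact T) {p : E} (hp : p ∈ T) (z : E) :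
    ⟪p, z⟫_ℝ + Metric.infDist p Tᶜ * ‖z‖ ≤ regularizedSupport T 0 z := by
  rcases eq_or_ne z 0 with rfl | hz
  · simpa using inner_le_regularizedSupport_zero hT hp 0
  have hz' : 0 < ‖z‖ := norm_pos_iff.2 hz
  have hball : Metric.closedBall p (Metric.infDist p Tᶜ) ⊆ T :=
    (Metric.closedBall_infDist_compl_subset_closure hp).trans_eq hT.isClosed.closure_eq
  have hmem : p + (Metric.infDist p Tᶜ / ‖z‖) • z ∈ T := hball <| by
    rw [Metric.mem_closedBall, dist_self_add_left, norm_smul, norm_div, norm_norm,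
      Real.norm_of_nonneg Metric.infDist_nonneg, div_mul_cancel₀ _ hz'.ne']
  have hle := inner_le_regularizedSupport_zero hT hmem z
  rwa [inner_add_left, real_inner_smul_left, real_inner_self_eq_norm_mul_norm, ← mul_assoc,
    div_mul_cancel₀ _ hz'.ne'] at hle

theorem exists_mem_ne_zero (hT : IsCompact T) {p : E} (hδ : 0 < Metric.infDist p Tᶜ)
    (hp : p ∈ T) : ∃ x ∈ T, x ≠ 0 := by
  by_contra! hzero
  obtain ⟨z, hz⟩ : Tᶜ.Nonempty := Set.nonempty_iff_ne_empty.2 fun h => by simp [h] at hδ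
  obtain rfl := hzero p hp
  obtain ⟨q, hq, hq_eq⟩ := exists_regularizedSupport_eq hT ⟨0, hp⟩ 0 z
  have hz₀ : 0 < ‖z‖ := norm_pos_iff.2 fun h => hz (h ▸ hp)
  have hslater := inner_add_infDist_mul_norm_le hT hp z
  rw [hq_eq, hzero q hq] at hslater
  simp only [inner_zero_left, norm_zero] at hslater
  linarith [mul_pos hδ hz₀]

theorem mem_of_forall_inner_le [CompleteSpace E] (hT : IsCompact T) (hconv : Convex ℝ T)
    (hne : T.Nonempty) {x : E} (h : ∀ d, ⟪x, d⟫_ℝ ≤ regularizedSupport T 0 d) : x ∈ T := by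
  by_contra hx
  obtain ⟨f, u, hfT, hfx⟩ := geometric_hahn_banach_closed_point hconv hT.isClosed hx
  have hf : ∀ v, ⟪v, (InnerProductSpace.toDual ℝ E).symm f⟫_ℝ = f v := fun v => by
    rw [real_inner_comm, InnerProductSpace.toDual_symm_apply]
  obtain ⟨q, hq, hq_eq⟩ :=
    exists_regularizedSupport_eq hT hne 0 ((InnerProductSpace.toDual ℝ E).symm f)
  have hle := h ((InnerProductSpace.toDual ℝ E).symm f)
  rw [hq_eq, hf, hf] at hle
  linarith [hfT q hq]

theorem mem_and_inner_eq_of_subgradient [CompleteSpace E] (hT : IsCompact T) (hconv : Convex ℝ T)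
    (hne : T.Nonempty) {x p : E}
    (h : ∀ z, regularizedSupport T 0 p + ⟪x, z - p⟫_ℝ ≤ regularizedSupport T 0 z) :
    x ∈ T ∧ regularizedSupport T 0 p = ⟪x, p⟫_ℝ := by
  have hx : x ∈ T := mem_of_forall_inner_le hT hconv hne fun d => by
    obtain ⟨q, hq, hq_eq⟩ := exists_regularizedSupport_eq hT hne 0 (p + d)
    have hsub := h (p + d)
    rw [hq_eq, add_sub_cancel_left, inner_add_right] at hsub
    linarith [inner_le_regularizedSupport_zero hT hq p, inner_le_regularizedSupport_zero hT hq d]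
  refine ⟨hx, le_antisymm ?_ (inner_le_regularizedSupport_zero hT hx p)⟩
  obtain ⟨q, -, hq_eq⟩ := exists_regularizedSupport_eq hT hne 0 (0 : E)
  have hsub := h 0
  rw [hq_eq, zero_sub, inner_neg_right, inner_zero_right] at hsub
  linarith

end SupportFunction

section ConstraintSet

open scoped Pointwise

variable {M : ℕ} {T : Set (EuclideanSpace ℝ (Fin M))} {y : Fin M → ℝ} {U : Fin M → Set ℝ}

theorem supportFn_eq_regularizedSupport (T : Set (EuclideanSpace ℝ (Fin M))) :
    supportFn T = regularizedSupport T 0 := by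
  funext z
  simp [supportFn, regularizedSupport]

theorem constraintSet_eq_preimage_pi : constraintSet y U =
    EuclideanSpace.equiv (Fin M) ℝ ⁻¹' Set.univ.pi fun i => {y i} - U i := by
  ext t
  simp [constraintSet, eq_comm]

theorem isCompact_constraintSet (hU : ∀ i, IsCompact (U i)) : IsCompact (constraintSet y U) := by
  rw [constraintSet_eq_preimage_pi]
  exact (EuclideanSpace.equiv (Fin M) ℝ).toHomeomorph.isCompact_preimage.2
    (isCompact_univ_pi fun i => by
      rw [Set.singleton_sub]
      exact (hU i).image (by fun_prop))

theorem convex_constraintSet (hU : ∀ i, Convex ℝ (U i)) : Convex ℝ (constraintSet y U) := by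
  rw [constraintSet_eq_preimage_pi]
  exact (convex_pi fun i _ => (convex_singleton (y i)).sub (hU i)).linear_preimage
    (EuclideanSpace.equiv (Fin M) ℝ).toLinearMap

theorem norm_sq_le_constD (hT : IsCompact T) {x : EuclideanSpace ℝ (Fin M)} (hx : x ∈ T) :
    ‖x‖ ^ 2 ≤ 2 * constD T := by
  have : ‖x‖ ^ 2 ≤ sSup ((fun x => ‖x‖ ^ 2) '' T) :=
    le_csSup (hT.image (by fun_prop)).bddAbove ⟨x, hx, rfl⟩
  rw [constD]
  linarith

theorem constD_pos (hT : IsCompact T) {p : EuclideanSpace ℝ (Fin M)}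
    (hδ : 0 < Metric.infDist p Tᶜ) (hp : p ∈ T) : 0 < constD T := by
  obtain ⟨x, hx, hx₀⟩ := exists_mem_ne_zero hT hδ hp
  have := norm_sq_le_constD hT hx
  have : 0 < ‖x‖ ^ 2 := by positivity
  linarith

end ConstraintSet

section RelativeEntropy

open InformationTheory

variable {Ω : Type*} [MeasurableSpace Ω] {μ ν : Measure Ω} {f : Ω → ℝ}

theorem integral_sub_log_integral_exp_le_klDiv [IsProbabilityMeasure μ] [IsProbabilityMeasure ν]
    (hfμ : Integrable f μ) (hfν : Integrable (fun ω => Real.exp (f ω)) ν) (hfin : klDiv μ ν ≠ ∞) :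
    ∫ ω, f ω ∂μ - Real.log (∫ ω, Real.exp (f ω) ∂ν) ≤ (klDiv μ ν).toReal := by
  obtain ⟨hac, hllr⟩ := klDiv_ne_top_iff.1 hfin
  have := isProbabilityMeasure_tilted hfν
  have htilted := toReal_klDiv_of_measure_eq (hac.trans (absolutelyContinuous_tilted hfν)) (by simp)
  rw [integral_llr_tilted_right hac hfμ hfν hllr,
    ← toReal_klDiv_of_measure_eq hac (by simp)] at htilted
  have : 0 ≤ (klDiv μ (ν.tilted f)).toReal := ENNReal.toReal_nonneg
  linarith

variable [IsProbabilityMeasure ν]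

theorem llr_tilted_self (hfν : Integrable (fun ω => Real.exp (f ω)) ν) :
    llr (ν.tilted f) ν =ᵐ[ν.tilted f] fun ω => f ω - Real.log (∫ ω, Real.exp (f ω) ∂ν) :=
  (tilted_absolutelyContinuous ν f).ae_le (log_rnDeriv_tilted_left_self hfν)

theorem klDiv_tilted_self_ne_top (hfν : Integrable (fun ω => Real.exp (f ω)) ν)
    (hf : Integrable f (ν.tilted f)) : klDiv (ν.tilted f) ν ≠ ∞ :=
  klDiv_ne_top (tilted_absolutelyContinuous ν f)
    ((hf.sub (integrable_const _)).congr (llr_tilted_self hfν).symm)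

theorem toReal_klDiv_tilted_self (hfν : Integrable (fun ω => Real.exp (f ω)) ν)
    (hf : Integrable f (ν.tilted f)) : (klDiv (ν.tilted f) ν).toReal =
      ∫ ω, f ω ∂(ν.tilted f) - Real.log (∫ ω, Real.exp (f ω) ∂ν) := by
  have := isProbabilityMeasure_tilted hfν
  rw [toReal_klDiv_of_measure_eq (tilted_absolutelyContinuous ν f) (by simp),
    integral_congr_ae (llr_tilted_self hfν), integral_sub hf (integrable_const _)]
  simp

theorem integral_le_log_integral_exp (hf : Integrable f ν)
    (hfν : Integrable (fun ω => Real.exp (f ω)) ν) :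
    ∫ ω, f ω ∂ν ≤ Real.log (∫ ω, Real.exp (f ω) ∂ν) := by
  simpa [klDiv_self] using integral_sub_log_integral_exp_le_klDiv hf hfν (by simp [klDiv_self])

theorem log_integral_exp_le (hf : AEMeasurable f ν) {r : ℝ} (hr : ∀ᵐ ω ∂ν, |f ω| ≤ r) :
    Real.log (∫ ω, Real.exp (f ω) ∂ν) ≤ ∫ ω, f ω ∂ν + r ^ 2 / 2 := by
  have hIcc : ∀ᵐ ω ∂ν, f ω ∈ Set.Icc (-r) r := hr.mono fun ω => abs_le.1
  have hoeffding := (ProbabilityTheory.hasSubgaussianMGF_of_mem_Icc hf hIcc).mgf_le 1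
  have hpos : 0 < ∫ ω, Real.exp (f ω) ∂ν :=
    integral_exp_pos (by
      simpa only [one_mul] using ProbabilityTheory.integrable_exp_mul_of_mem_Icc (t := 1) hf hIcc)
  simp only [ProbabilityTheory.mgf, one_mul, sub_eq_add_neg, Real.exp_add, integral_mul_const]
    at hoeffding
  have hlog := Real.log_le_log (by positivity) hoeffding
  rw [Real.log_mul hpos.ne' (Real.exp_pos _).ne', Real.log_exp, Real.log_exp] at hlog
  have hvariance : (((‖r + - -r‖₊ / 2 : NNReal) ^ 2 : NNReal) : ℝ) = r ^ 2 := by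
    push_cast
    rw [div_pow, Real.norm_eq_abs, sq_abs]
    ring
  rw [hvariance] at hlog
  linarith

end RelativeEntropy

section ExponentialFamily

open InformationTheory

variable {Ω : Type*} [MeasurableSpace Ω] {E : Type*} [NormedAddCommGroup E] [InnerProductSpace ℝ E]

/-- The log-partition function of the exponential family with base measure `ν` and sufficient
statistic `φ`. -/
noncomputable def logPartition (ν : Measure Ω) (φ : Ω → E) (θ : E) : ℝ :=
  Real.log (∫ ω, Real.exp ⟪φ ω, θ⟫_ℝ ∂ν)

/-- The member with natural parameter `θ` of the exponential family with base measure `ν` and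
sufficient statistic `φ`. -/
noncomputable def expFamily (ν : Measure Ω) (φ : Ω → E) (θ : E) : Measure Ω :=
  ν.tilted fun ω => ⟪φ ω, θ⟫_ℝ

variable {μ ν : Measure Ω} {φ : Ω → E} {R : ℝ}

theorem aestronglyMeasurable_inner_const (hφ : AEStronglyMeasurable φ ν) (θ : E) :
    AEStronglyMeasurable (fun ω => ⟪φ ω, θ⟫_ℝ) ν :=
  hφ.inner aestronglyMeasurable_const

theorem abs_inner_le_ae (hR : ∀ᵐ ω ∂ν, ‖φ ω‖ ≤ R) (θ : E) :
    ∀ᵐ ω ∂ν, |⟪φ ω, θ⟫_ℝ| ≤ R * ‖θ‖ := by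
  filter_upwards [hR] with ω hω
  exact (abs_real_inner_le_norm _ _).trans (by gcongr)

variable [IsProbabilityMeasure ν]

theorem integrable_inner_const (hφ : AEStronglyMeasurable φ ν) (hR : ∀ᵐ ω ∂ν, ‖φ ω‖ ≤ R)
    (θ : E) : Integrable (fun ω => ⟪φ ω, θ⟫_ℝ) ν :=
  .of_bound (aestronglyMeasurable_inner_const hφ θ) (R * ‖θ‖) (abs_inner_le_ae hR θ)

theorem integrable_exp_inner_const (hφ : AEStronglyMeasurable φ ν) (hR : ∀ᵐ ω ∂ν, ‖φ ω‖ ≤ R)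
    (θ : E) : Integrable (fun ω => Real.exp ⟪φ ω, θ⟫_ℝ) ν := by
  refine .of_bound (Real.continuous_exp.comp_aestronglyMeasurable
    (aestronglyMeasurable_inner_const hφ θ)) (Real.exp (R * ‖θ‖)) ?_
  filter_upwards [abs_inner_le_ae hR θ] with ω hω
  rw [Real.norm_eq_abs, Real.abs_exp]
  gcongr
  exact (le_abs_self _).trans hω

theorem isProbabilityMeasure_expFamily (hφ : AEStronglyMeasurable φ ν)
    (hR : ∀ᵐ ω ∂ν, ‖φ ω‖ ≤ R) (θ : E) : IsProbabilityMeasure (expFamily ν φ θ) :=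
  isProbabilityMeasure_tilted (integrable_exp_inner_const hφ hR θ)

theorem expFamily_absolutelyContinuous (ν : Measure Ω) (φ : Ω → E) (θ : E) :
    expFamily ν φ θ ≪ ν :=
  tilted_absolutelyContinuous ν _

theorem logPartition_add (hφ : AEStronglyMeasurable φ ν) (hR : ∀ᵐ ω ∂ν, ‖φ ω‖ ≤ R) (θ d : E) :
    logPartition ν φ (θ + d) = logPartition ν φ θ + logPartition (expFamily ν φ θ) φ d := by
  have hθ := integral_exp_pos (integrable_exp_inner_const hφ hR θ)
  have hθd := integral_exp_pos (integrable_exp_inner_const hφ hR (θ + d))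
  have hadd : ((fun ω => ⟪φ ω, θ⟫_ℝ) + fun ω => ⟪φ ω, d⟫_ℝ) = fun ω => ⟪φ ω, θ + d⟫_ℝ := by
    ext ω
    exact (inner_add_right _ _ _).symm
  rw [logPartition, logPartition, logPartition, expFamily, integral_exp_tilted, hadd,
    Real.log_div hθd.ne' hθ.ne']
  ring

theorem klDiv_expFamily_ne_top (hφ : AEStronglyMeasurable φ ν) (hR : ∀ᵐ ω ∂ν, ‖φ ω‖ ≤ R)
    (θ : E) : klDiv (expFamily ν φ θ) ν ≠ ∞ := by
  have hac := expFamily_absolutelyContinuous ν φ θ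
  have := isProbabilityMeasure_expFamily hφ hR θ
  exact klDiv_tilted_self_ne_top (integrable_exp_inner_const hφ hR θ)
    (integrable_inner_const (hφ.mono_ac hac) (hac.ae_le hR) θ)

variable [CompleteSpace E]

theorem integral_inner_const (hφ : AEStronglyMeasurable φ ν) (hR : ∀ᵐ ω ∂ν, ‖φ ω‖ ≤ R) (θ : E) :
    ∫ ω, ⟪φ ω, θ⟫_ℝ ∂ν = ⟪∫ ω, φ ω ∂ν, θ⟫_ℝ := by
  simp_rw [real_inner_comm θ]
  exact integral_inner (.of_bound hφ R hR) θ

theorem hasQuadraticBounds_logPartition (hφ : AEStronglyMeasurable φ ν)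
    (hR : ∀ᵐ ω ∂ν, ‖φ ω‖ ≤ R) :
    HasQuadraticBounds (logPartition ν φ) (fun θ => ∫ ω, φ ω ∂(expFamily ν φ θ)) 0 (R ^ 2) := by
  intro θ d
  have := isProbabilityMeasure_expFamily hφ hR θ
  have hφθ := hφ.mono_ac (expFamily_absolutelyContinuous ν φ θ)
  have hRθ := (expFamily_absolutelyContinuous ν φ θ).ae_le hR
  have hlower := integral_le_log_integral_exp (integrable_inner_const hφθ hRθ d)
    (integrable_exp_inner_const hφθ hRθ d)
  have hupper := log_integral_exp_le (aestronglyMeasurable_inner_const hφθ d).aemeasurable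
    (abs_inner_le_ae hRθ d)
  rw [integral_inner_const hφθ hRθ] at hlower hupper
  rw [logPartition_add hφ hR]
  unfold logPartition
  constructor <;> linarith

theorem inner_integral_sub_logPartition_le_klDiv [IsProbabilityMeasure μ]
    (hφ : AEStronglyMeasurable φ ν) (hR : ∀ᵐ ω ∂ν, ‖φ ω‖ ≤ R) (hfin : klDiv μ ν ≠ ∞) (θ : E) :
    ⟪∫ ω, φ ω ∂μ, θ⟫_ℝ - logPartition ν φ θ ≤ (klDiv μ ν).toReal := by
  have hac := (klDiv_ne_top_iff.1 hfin).1
  rw [← integral_inner_const (hφ.mono_ac hac) (hac.ae_le hR)]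
  exact integral_sub_log_integral_exp_le_klDiv
    (integrable_inner_const (hφ.mono_ac hac) (hac.ae_le hR) θ)
    (integrable_exp_inner_const hφ hR θ) hfin

theorem toReal_klDiv_expFamily (hφ : AEStronglyMeasurable φ ν) (hR : ∀ᵐ ω ∂ν, ‖φ ω‖ ≤ R)
    (θ : E) : (klDiv (expFamily ν φ θ) ν).toReal =
      ⟪∫ ω, φ ω ∂(expFamily ν φ θ), θ⟫_ℝ - logPartition ν φ θ := by
  have hac := expFamily_absolutelyContinuous ν φ θ
  have := isProbabilityMeasure_expFamily hφ hR θ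
  rw [← integral_inner_const (hφ.mono_ac hac) (hac.ae_le hR)]
  exact toReal_klDiv_tilted_self (integrable_exp_inner_const hφ hR θ)
    (integrable_inner_const (hφ.mono_ac hac) (hac.ae_le hR) θ)

end ExponentialFamily

section BitEntropy

variable {Ω : Type*} [MeasurableSpace Ω] {μ ν : Measure Ω}

theorem relEnt_ne_top_iff : relEnt μ ν ≠ ∞ ↔ InformationTheory.klDiv μ ν ≠ ∞ := by
  simp [relEnt, ENNReal.div_eq_top, Real.log_pos one_lt_two]

theorem toReal_relEnt (μ ν : Measure Ω) :
    (relEnt μ ν).toReal = (Real.log 2)⁻¹ * (InformationTheory.klDiv μ ν).toReal := by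
  rw [relEnt, ENNReal.toReal_div, ENNReal.toReal_ofReal (Real.log_nonneg one_le_two),
    div_eq_inv_mul]

theorem toReal_relEnt_pos [IsFiniteMeasure μ] [IsFiniteMeasure ν] (hfin : relEnt μ ν ≠ ∞)
    (hne : μ ≠ ν) : 0 < (relEnt μ ν).toReal := by
  rw [toReal_relEnt]
  exact mul_pos (inv_pos.2 (Real.log_pos one_lt_two))
    (ENNReal.toReal_pos (mt InformationTheory.klDiv_eq_zero_iff.1 hne) (relEnt_ne_top_iff.1 hfin))

end BitEntropy

section MomentOperator

variable {K : Set ℝ} {M : ℕ}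

/-- The curve `x ↦ (x, x ^ 2, …, x ^ M)`, whose average under `μ` is the moment vector of `μ`. -/
noncomputable def momentCurve (M : ℕ) (x : ℝ) : EuclideanSpace ℝ (Fin M) :=
  WithLp.toLp 2 fun i => x ^ ((i : ℕ) + 1)

theorem continuous_momentCurve : Continuous (momentCurve M) := by
  unfold momentCurve
  fun_prop

theorem adjointMoments_eq_inner (z : EuclideanSpace ℝ (Fin M)) (x : ℝ) :
    adjointMoments z x = ⟪momentCurve M x, z⟫_ℝ := by
  simp [adjointMoments, momentCurve, PiLp.inner_apply]

theorem aestronglyMeasurable_momentCurve (μ : Measure K) :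
    AEStronglyMeasurable (fun x : K => momentCurve M x) μ :=
  (continuous_momentCurve.comp continuous_subtype_val).aestronglyMeasurable

theorem exists_norm_momentCurve_le (K : Set ℝ) [CompactSpace K] (M : ℕ) :
    ∃ R, ∀ x : K, ‖momentCurve M x‖ ≤ R := by
  have hc : Continuous fun x : K => ‖momentCurve M x‖ :=
    (continuous_momentCurve.comp continuous_subtype_val).norm
  obtain ⟨R, hR⟩ := (isCompact_range hc).bddAbove
  exact ⟨R, fun x => hR ⟨x, rfl⟩⟩

variable [CompactSpace K]

theorem moments_eq_integral (μ : Measure K) [IsFiniteMeasure μ] :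
    moments M μ = ∫ x : K, momentCurve M x ∂μ := by
  have hint : ∀ i : Fin M, Integrable (fun x : K => momentCurve M x i) μ := fun i =>
    Continuous.integrable_of_hasCompactSupport (by unfold momentCurve; fun_prop)
      (.of_compactSpace _)
  ext i
  rw [eval_integral_piLp hint]
  rfl

theorem norm_moments_le {R : ℝ} (hR : ∀ x : K, ‖momentCurve M x‖ ≤ R) (μ : Measure K)
    [IsFiniteMeasure μ] : ‖moments M μ‖ ≤ R * μ.real Set.univ := by
  rw [moments_eq_integral]
  exact norm_integral_le_of_norm_le_const (ae_of_all _ hR)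

theorem norm_signedMoments_le {R : ℝ} (hR : ∀ x : K, ‖momentCurve M x‖ ≤ R)
    (s : SignedMeasure K) :
    ‖signedMoments M s‖ ≤ R * (s.totalVariation Set.univ).toReal := by
  have hmass : (s.totalVariation Set.univ).toReal =
      s.toJordanDecomposition.posPart.real Set.univ +
        s.toJordanDecomposition.negPart.real Set.univ := by
    rw [SignedMeasure.totalVariation, Measure.add_apply,
      ENNReal.toReal_add (by finiteness) (by finiteness), measureReal_def, measureReal_def]
  calc ‖signedMoments M s‖ ≤ ‖moments M s.toJordanDecomposition.posPart‖ +
        ‖moments M s.toJordanDecomposition.negPart‖ := norm_sub_le _ _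
    _ ≤ R * (s.totalVariation Set.univ).toReal := by
      rw [hmass, mul_add]
      exact add_le_add (norm_moments_le hR _) (norm_moments_le hR _)

theorem inner_signedMoments_le_momentNorm {s : SignedMeasure K}
    (hs : s.totalVariation Set.univ = 1) {v : EuclideanSpace ℝ (Fin M)} (hv : ‖v‖ = 1) :
    ⟪signedMoments M s, v⟫_ℝ ≤ momentNorm K M := by
  obtain ⟨R, hR⟩ := exists_norm_momentCurve_le K M
  refine le_csSup ⟨R, ?_⟩ ⟨s, v, hs, hv, rfl⟩
  rintro r ⟨s, v, hs, hv, rfl⟩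
  calc ⟪signedMoments M s, v⟫_ℝ ≤ ‖signedMoments M s‖ * ‖v‖ := real_inner_le_norm _ _
    _ ≤ R := by simpa [hv, hs] using norm_signedMoments_le hR s

theorem inner_momentCurve_le_momentNorm (x : K) {v : EuclideanSpace ℝ (Fin M)} (hv : ‖v‖ = 1) :
    ⟪momentCurve M x, v⟫_ℝ ≤ momentNorm K M := by
  let dirac : JordanDecomposition K :=
    { posPart := Measure.dirac x
      negPart := 0
      posPart_finite := inferInstance
      negPart_finite := inferInstance
      mutuallySingular := Measure.MutuallySingular.zero_right }
  have hdirac : dirac.toSignedMeasure.toJordanDecomposition = dirac :=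
    SignedMeasure.toJordanDecomposition_eq rfl
  have hmoments : signedMoments M dirac.toSignedMeasure = momentCurve M x := by
    ext i
    simp [signedMoments, hdirac, dirac, moments, momentCurve]
  have hmass : dirac.toSignedMeasure.totalVariation Set.univ = 1 := by
    simp [SignedMeasure.totalVariation, hdirac, dirac]
  exact hmoments ▸ inner_signedMoments_le_momentNorm hmass hv

theorem norm_momentCurve_le_momentNorm (x : K) : ‖momentCurve M x‖ ≤ momentNorm K M := by
  rcases subsingleton_or_nontrivial (EuclideanSpace ℝ (Fin M)) with _ | _
  · rw [Subsingleton.elim (momentCurve M x) 0, norm_zero]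
    refine Real.sSup_nonneg ?_
    rintro r ⟨s, v, -, hv, rfl⟩
    simp [Subsingleton.elim v 0] at hv
  rcases eq_or_ne (momentCurve M x) 0 with h₀ | h₀
  · obtain ⟨v, hv⟩ := exists_norm_eq (EuclideanSpace ℝ (Fin M)) zero_le_one
    simpa [h₀] using inner_momentCurve_le_momentNorm x hv
  · have hnorm : ‖momentCurve M x‖ ≠ 0 := norm_ne_zero_iff.2 h₀
    have hle := inner_momentCurve_le_momentNorm x (v := ‖momentCurve M x‖⁻¹ • momentCurve M x)
      (by rw [norm_smul, norm_inv, norm_norm, inv_mul_cancel₀ hnorm])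
    rwa [real_inner_smul_right, real_inner_self_eq_norm_sq, pow_two,
      inv_mul_cancel_left₀ hnorm] at hle

end MomentOperator

section Gibbs

variable {K : Set ℝ} {M : ℕ}

/-- The logarithm to base `2` of the partition function `∫ 2 ^ (-𝒜* z) dν`. Passing to the base `2`
amounts to the natural parameter `-log 2 • z` in the exponential family of `momentCurve`. -/
noncomputable def binaryLogPartition (ν : Measure K) (z : EuclideanSpace ℝ (Fin M)) : ℝ :=
  (Real.log 2)⁻¹ * logPartition ν (fun x : K => momentCurve M x) (-Real.log 2 • z)

variable [CompactSpace K] (ν : ProbabilityMeasure K) (z : EuclideanSpace ℝ (Fin M))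

theorem norm_momentCurve_le_momentNorm_ae (μ : Measure K) :
    ∀ᵐ x : K ∂μ, ‖momentCurve M x‖ ≤ momentNorm K M :=
  ae_of_all _ norm_momentCurve_le_momentNorm

theorem gibbs_eq_expFamily :
    gibbs ν z = expFamily (ν : Measure K) (fun x : K => momentCurve M x) (-Real.log 2 • z) := by
  set f : K → ℝ := fun x => ⟪momentCurve M x, -Real.log 2 • z⟫_ℝ with hf
  have hrpow : ∀ x : K, (2 : ℝ) ^ (-adjointMoments z x) = Real.exp (f x) := fun x => by
    simp only [Real.rpow_def_of_pos two_pos, hf, adjointMoments_eq_inner, real_inner_smul_right,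
      neg_mul, mul_neg]
  have hint : Integrable (fun x => Real.exp (f x)) (ν : Measure K) :=
    integrable_exp_inner_const (aestronglyMeasurable_momentCurve _)
      (norm_momentCurve_le_momentNorm_ae _) _
  have hmeas : Measurable fun x => ENNReal.ofReal (Real.exp (f x)) := by
    have : Continuous f := by
      have := (continuous_momentCurve (M := M)).comp (continuous_subtype_val (p := (· ∈ K)))
      exact this.inner continuous_const
    fun_prop
  have hpos := integral_exp_pos hint
  simp only [gibbs, expFamily, hrpow, Measure.tilted]
  rw [← ofReal_integral_eq_lintegral_ofReal hint (ae_of_all _ fun x => (Real.exp_pos _).le),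
    ← withDensity_smul _ hmeas]
  congr 1
  ext x
  rw [Pi.smul_apply, smul_eq_mul, div_eq_inv_mul, ENNReal.ofReal_mul (inv_nonneg.2 hpos.le),
    ENNReal.ofReal_inv_of_pos hpos]

theorem isProbabilityMeasure_gibbs : IsProbabilityMeasure (gibbs ν z) := by
  rw [gibbs_eq_expFamily]
  exact isProbabilityMeasure_expFamily (aestronglyMeasurable_momentCurve _)
    (norm_momentCurve_le_momentNorm_ae _) _

theorem relEnt_gibbs_ne_top : relEnt (gibbs ν z) ν ≠ ∞ := by
  rw [relEnt_ne_top_iff, gibbs_eq_expFamily]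
  exact klDiv_expFamily_ne_top (aestronglyMeasurable_momentCurve _)
    (norm_momentCurve_le_momentNorm_ae _) _

theorem toReal_relEnt_gibbs : (relEnt (gibbs ν z) ν).toReal =
    -binaryLogPartition (ν : Measure K) z - ⟪moments M (gibbs ν z), z⟫_ℝ := by
  have := isProbabilityMeasure_gibbs ν z
  rw [toReal_relEnt, moments_eq_integral, gibbs_eq_expFamily,
    toReal_klDiv_expFamily (aestronglyMeasurable_momentCurve _)
      (norm_momentCurve_le_momentNorm_ae _), real_inner_smul_right, binaryLogPartition]
  field_simp
  ring

theorem neg_binaryLogPartition_le {μ : Measure K} [IsProbabilityMeasure μ]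
    (hfin : relEnt μ ν ≠ ∞) :
    -binaryLogPartition (ν : Measure K) z ≤ (relEnt μ ν).toReal + ⟪moments M μ, z⟫_ℝ := by
  have hle := inner_integral_sub_logPartition_le_klDiv (aestronglyMeasurable_momentCurve _)
    (norm_momentCurve_le_momentNorm_ae _) (relEnt_ne_top_iff.1 hfin) (-Real.log 2 • z)
  rw [← moments_eq_integral, real_inner_smul_right] at hle
  rw [toReal_relEnt, binaryLogPartition]
  refine le_of_mul_le_mul_left ?_ (Real.log_pos one_lt_two)
  rw [mul_add, mul_neg, mul_inv_cancel_left₀ (Real.log_pos one_lt_two).ne',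
    mul_inv_cancel_left₀ (Real.log_pos one_lt_two).ne']
  linarith

theorem hasQuadraticBounds_binaryLogPartition :
    HasQuadraticBounds (binaryLogPartition (M := M) (ν : Measure K))
      (fun z => -moments M (gibbs ν z)) 0 (momentNorm K M ^ 2) := by
  have hbase := ((hasQuadraticBounds_logPartition (aestronglyMeasurable_momentCurve (ν : Measure K))
    (norm_momentCurve_le_momentNorm_ae (M := M) _)).comp_smul (-Real.log 2)).const_mul
    (inv_nonneg.2 (Real.log_nonneg one_le_two))
  have hlog : Real.log 2 ≠ 0 := (Real.log_pos one_lt_two).ne'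
  have hcurvature : (Real.log 2)⁻¹ * ((-Real.log 2) ^ 2 * momentNorm K M ^ 2) ≤
      momentNorm K M ^ 2 := by
    have : Real.log 2 ≤ 1 := Real.log_two_lt_d9.le.trans (by norm_num)
    calc (Real.log 2)⁻¹ * ((-Real.log 2) ^ 2 * momentNorm K M ^ 2)
        = Real.log 2 * momentNorm K M ^ 2 := by field_simp
      _ ≤ momentNorm K M ^ 2 := mul_le_of_le_one_left (sq_nonneg _) this
  have hgradient : ∀ z, (Real.log 2)⁻¹ • -Real.log 2 • ∫ x : K, momentCurve M x
      ∂(expFamily (ν : Measure K) (fun x : K => momentCurve M x) (-Real.log 2 • z)) =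
        -moments M (gibbs ν z) := fun z => by
    have := isProbabilityMeasure_gibbs ν z
    rw [moments_eq_integral, gibbs_eq_expFamily, neg_smul, smul_neg, inv_smul_smul₀ hlog]
  simp only [hgradient, mul_zero] at hbase
  exact hbase.mono_right hcurvature

theorem entropyTerm_eq_neg_binaryLogPartition :
    entropyTerm ν z = -binaryLogPartition (ν : Measure K) z := by
  have := isProbabilityMeasure_gibbs ν z
  suffices h : (⨅ μ : ProbabilityMeasure K, ((relEnt (μ : Measure K) ν : ℝ≥0∞) : EReal) +
      ((⟪moments M (μ : Measure K), z⟫_ℝ : ℝ) : EReal)) =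
        ((-binaryLogPartition (ν : Measure K) z : ℝ) : EReal) by
    rw [entropyTerm, h, EReal.toReal_coe]
  refine le_antisymm (iInf_le_of_le ⟨gibbs ν z, this⟩ ?_) (le_iInf fun μ => ?_)
  · rw [ProbabilityMeasure.coe_mk, ← EReal.coe_ennreal_toReal (relEnt_gibbs_ne_top ν z),
      ← EReal.coe_add, toReal_relEnt_gibbs, sub_add_cancel]
  · by_cases hfin : relEnt (μ : Measure K) ν = ∞
    · rw [hfin, EReal.coe_ennreal_top, EReal.top_add_coe]
      exact le_top
    · rw [← EReal.coe_ennreal_toReal hfin, ← EReal.coe_add, EReal.coe_le_coe_iff]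
      exact neg_binaryLogPartition_le ν z hfin

end Gibbs

section Slater

variable {K : Set ℝ} {M : ℕ} {ν μ₀ : ProbabilityMeasure K} {T : Set (EuclideanSpace ℝ (Fin M))}

/-- A Slater point of the entropy minimization: a measure of finite relative entropy whose moment
vector lies in the interior of `T`. Interiority is encoded by `0 < constδ T μ₀`, which also gives
feasibility because `Metric.infDist · Tᶜ` vanishes on `Tᶜ`. -/
structure IsSlaterPoint (ν : ProbabilityMeasure K) (T : Set (EuclideanSpace ℝ (Fin M)))
    (μ₀ : ProbabilityMeasure K) : Prop where
  relEnt_ne_top : relEnt (μ₀ : Measure K) ν ≠ ∞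
  constδ_pos : 0 < constδ T μ₀

namespace IsSlaterPoint

theorem moments_mem (h : IsSlaterPoint ν T μ₀) : moments M (μ₀ : Measure K) ∈ T :=
  of_not_not fun hmem => h.constδ_pos.ne' (Metric.infDist_zero_of_mem hmem)

theorem nonempty (h : IsSlaterPoint ν T μ₀) : T.Nonempty :=
  ⟨_, h.moments_mem⟩

theorem constC_pos (h : IsSlaterPoint ν T μ₀) (hne : μ₀ ≠ ν) : 0 < constC ν μ₀ :=
  toReal_relEnt_pos h.relEnt_ne_top (mt Subtype.ext hne)

theorem primalValue_ne_top (h : IsSlaterPoint ν T μ₀) : primalValue ν T ≠ ∞ :=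
  ne_top_of_le_ne_top h.relEnt_ne_top (iInf₂_le μ₀ h.moments_mem)

theorem toReal_primalValue_le (h : IsSlaterPoint ν T μ₀) :
    (primalValue ν T).toReal ≤ constC ν μ₀ :=
  ENNReal.toReal_mono h.relEnt_ne_top (iInf₂_le μ₀ h.moments_mem)

end IsSlaterPoint

end Slater

section Duality

variable {K : Set ℝ} {M : ℕ} {ν μ₀ : ProbabilityMeasure K} {T : Set (EuclideanSpace ℝ (Fin M))}
  [CompactSpace K]

theorem dualFn_eq (ν : ProbabilityMeasure K) (T : Set (EuclideanSpace ℝ (Fin M)))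
    (z : EuclideanSpace ℝ (Fin M)) :
    dualFn ν T z = -regularizedSupport T 0 z - binaryLogPartition (ν : Measure K) z := by
  rw [dualFn, supportFn_eq_regularizedSupport, entropyTerm_eq_neg_binaryLogPartition,
    sub_eq_add_neg]

theorem dualFn_zero (hT : IsCompact T) (hne : T.Nonempty) : dualFn ν T 0 = 0 := by
  obtain ⟨p, -, hp⟩ := exists_regularizedSupport_eq hT hne 0 0
  simp [dualFn_eq, hp, binaryLogPartition, logPartition]

theorem dualFn_le_toReal_primalValue (hT : IsCompact T) (hfin : primalValue ν T ≠ ∞)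
    (z : EuclideanSpace ℝ (Fin M)) : dualFn ν T z ≤ (primalValue ν T).toReal := by
  rw [← ENNReal.ofReal_le_iff_le_toReal hfin]
  refine le_iInf₂ fun μ hμ => ?_
  by_cases hμfin : relEnt (μ : Measure K) ν = ∞
  · exact hμfin ▸ le_top
  · rw [ENNReal.ofReal_le_iff_le_toReal hμfin, dualFn_eq]
    linarith [neg_binaryLogPartition_le ν z hμfin, inner_le_regularizedSupport_zero hT hμ z]

theorem IsSlaterPoint.dualFn_le (h : IsSlaterPoint ν T μ₀) (hT : IsCompact T)
    (z : EuclideanSpace ℝ (Fin M)) : dualFn ν T z ≤ constC ν μ₀ - constδ T μ₀ * ‖z‖ := by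
  have hsupport := inner_add_infDist_mul_norm_le hT h.moments_mem z
  have hentropy := neg_binaryLogPartition_le ν z h.relEnt_ne_top
  rw [dualFn_eq, constC, constδ]
  linarith

theorem continuous_dualFn (hT : IsCompact T) (hne : T.Nonempty) : Continuous (dualFn ν T) := by
  rw [funext (dualFn_eq ν T)]
  exact (continuous_regularizedSupport hT hne 0).neg.sub
    (hasQuadraticBounds_binaryLogPartition ν).continuous

theorem IsSlaterPoint.exists_forall_dualFn_le (h : IsSlaterPoint ν T μ₀) (hT : IsCompact T) :
    ∃ p, ∀ z, dualFn ν T z ≤ dualFn ν T p := by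
  refine (continuous_dualFn hT h.nonempty).exists_forall_ge ?_
  refine tendsto_atBot_mono (h.dualFn_le hT) ?_
  simp only [sub_eq_add_neg]
  exact tendsto_atBot_add_const_left _ _ (tendsto_neg_atTop_atBot.comp
    ((tendsto_norm_cocompact_atTop (E := EuclideanSpace ℝ (Fin M))).const_mul_atTop h.constδ_pos))

theorem gibbs_feasible_of_isMax (hT : IsCompact T) (hconv : Convex ℝ T) (hne : T.Nonempty)
    {p : EuclideanSpace ℝ (Fin M)} (hp : ∀ z, dualFn ν T z ≤ dualFn ν T p) :
    moments M (gibbs ν p) ∈ T ∧ regularizedSupport T 0 p = ⟪moments M (gibbs ν p), p⟫_ℝ := by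
  have hmin : IsMinOn (fun z => regularizedSupport T 0 z + binaryLogPartition (ν : Measure K) z)
      Set.univ p := fun z _ => by
    have := hp z
    rw [dualFn_eq, dualFn_eq] at this
    rw [Set.mem_ofPred_eq]
    linarith
  refine mem_and_inner_eq_of_subgradient hT hconv hne fun z => ?_
  have := (hasQuadraticBounds_binaryLogPartition ν).le_add_inner_of_isMinOn
    (convexOn_regularizedSupport hT hne 0) hmin (Set.mem_univ p) (Set.mem_univ z)
  rw [inner_neg_left] at this
  linarith

theorem IsSlaterPoint.exists_dualFn_eq_primalValue (h : IsSlaterPoint ν T μ₀) (hT : IsCompact T)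
    (hconv : Convex ℝ T) :
    ∃ p, dualFn ν T p = (primalValue ν T).toReal ∧ constδ T μ₀ * ‖p‖ ≤ constC ν μ₀ := by
  obtain ⟨p, hp⟩ := h.exists_forall_dualFn_le hT
  obtain ⟨hmem, hslack⟩ := gibbs_feasible_of_isMax hT hconv h.nonempty hp
  refine ⟨p, (dualFn_le_toReal_primalValue hT h.primalValue_ne_top p).antisymm ?_, ?_⟩
  · calc (primalValue ν T).toReal ≤ (relEnt (gibbs ν p) ν).toReal :=
        ENNReal.toReal_mono (relEnt_gibbs_ne_top ν p)
          (iInf₂_le (⟨gibbs ν p, isProbabilityMeasure_gibbs ν p⟩ : ProbabilityMeasure K) hmem)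
      _ = dualFn ν T p := by
        rw [toReal_relEnt_gibbs, dualFn_eq, hslack]
        ring
  · have := dualFn_zero (ν := ν) hT h.nonempty ▸ hp 0
    linarith [h.dualFn_le hT p]

end Duality

section Smoothing

variable {K : Set ℝ} {M : ℕ} {ν : ProbabilityMeasure K} {T : Set (EuclideanSpace ℝ (Fin M))}
  {η₁ η₂ : ℝ}

theorem smoothedDualFn_eq (z : EuclideanSpace ℝ (Fin M)) :
    smoothedDualFn ν T η₁ η₂ z =
      -regularizedSupport T η₁ z + entropyTerm ν z - η₂ / 2 * ‖z‖ ^ 2 :=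
  rfl

theorem dualFn_sub_norm_sq_le_smoothedDualFn (hT : IsCompact T) (hne : T.Nonempty) (hη₁ : 0 ≤ η₁)
    (z : EuclideanSpace ℝ (Fin M)) :
    dualFn ν T z - η₂ / 2 * ‖z‖ ^ 2 ≤ smoothedDualFn ν T η₁ η₂ z := by
  have := regularizedSupport_anti hT hne z hη₁
  rw [dualFn, supportFn_eq_regularizedSupport, smoothedDualFn_eq]
  linarith

theorem smoothedDualFn_le_dualFn_sub_norm_sq (hT : IsCompact T) (hne : T.Nonempty) (hη₁ : 0 ≤ η₁)
    (z : EuclideanSpace ℝ (Fin M)) :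
    smoothedDualFn ν T η₁ η₂ z ≤ dualFn ν T z + η₁ * constD T - η₂ / 2 * ‖z‖ ^ 2 := by
  have := regularizedSupport_le_add hT hne hη₁ (fun _ => norm_sq_le_constD hT) z
  rw [dualFn, supportFn_eq_regularizedSupport, smoothedDualFn_eq]
  linarith

theorem hasQuadraticBounds_neg_smoothedDualFn [CompactSpace K] (hT : IsCompact T)
    (hconv : Convex ℝ T) (hη₁ : 0 < η₁) (η₂ : ℝ)
    {q : EuclideanSpace ℝ (Fin M) → EuclideanSpace ℝ (Fin M)} (hqT : ∀ z, q z ∈ T)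
    (hq : ∀ z, regularizedSupport T η₁ z = ⟪q z, z⟫_ℝ - η₁ / 2 * ‖q z‖ ^ 2) :
    HasQuadraticBounds (fun z => -smoothedDualFn ν T η₁ η₂ z)
      (fun z => q z - moments M (gibbs ν z) + η₂ • z) η₂ (lipConst K M η₁ η₂) := by
  convert ((hasQuadraticBounds_regularizedSupport hT hconv hη₁ hqT hq).add
    (hasQuadraticBounds_binaryLogPartition ν)).add (hasQuadraticBounds_norm_sq η₂) using 1
  · funext z
    rw [smoothedDualFn_eq, entropyTerm_eq_neg_binaryLogPartition]
    ring
  · funext z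
    rw [sub_eq_add_neg]
  · ring
  · rfl

end Smoothing

section Accuracy

variable {K : Set ℝ} {M : ℕ} {ν : ProbabilityMeasure K} {T : Set (EuclideanSpace ℝ (Fin M))}
  {η₁ η₂ ε r γ : ℝ} {p q z : EuclideanSpace ℝ (Fin M)}

theorem dualFn_le_of_smoothedDualFn_sub_le (hT : IsCompact T) (hne : T.Nonempty) (hη₁ : 0 ≤ η₁)
    (hgap : smoothedDualFn ν T η₁ η₂ p - smoothedDualFn ν T η₁ η₂ z ≤ γ) :
    dualFn ν T p ≤
      dualFn ν T z - η₂ / 2 * ‖z‖ ^ 2 + η₂ / 2 * ‖p‖ ^ 2 + η₁ * constD T + γ := by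
  linarith [dualFn_sub_norm_sq_le_smoothedDualFn (ν := ν) (η₂ := η₂) hT hne hη₁ p,
    smoothedDualFn_le_dualFn_sub_norm_sq (ν := ν) (η₂ := η₂) hT hne hη₁ z]

theorem dualFn_gap_and_norm_le (hT : IsCompact T) (hne : T.Nonempty) (hε : 0 < ε) (hr : 0 < r)
    (hη₁ : 0 ≤ η₁) (hη₁D : η₁ * constD T = ε / 4) (hη₂ : η₂ = ε / (2 * r ^ 2)) (hp : ‖p‖ ≤ r)
    (hzp : dualFn ν T z ≤ dualFn ν T p)
    (hgap : smoothedDualFn ν T η₁ η₂ p - smoothedDualFn ν T η₁ η₂ z ≤ ε / 100) :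
    dualFn ν T p - dualFn ν T z ≤ ε ∧ ‖z‖ ≤ 3 / 2 * r := by
  have hle := dualFn_le_of_smoothedDualFn_sub_le hT hne hη₁ hgap
  have hηr : η₂ * r ^ 2 = ε / 2 := by
    rw [hη₂]
    field_simp
  have hη₂pos : 0 < η₂ := hη₂ ▸ by positivity
  have hpr : η₂ / 2 * ‖p‖ ^ 2 ≤ η₂ / 2 * r ^ 2 := by gcongr
  have hz₀ : 0 ≤ η₂ / 2 * ‖z‖ ^ 2 := by positivity
  refine ⟨by linarith, (sq_le_sq₀ (norm_nonneg z) (by positivity)).1 ?_⟩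
  refine le_of_mul_le_mul_left ?_ (half_pos hη₂pos)
  linarith

theorem abs_relEnt_gibbs_sub_dualFn_le [CompactSpace K] (hT : IsCompact T) (hη₁ : 0 ≤ η₁)
    (hη₂ : 0 ≤ η₂) (hq : q ∈ T)
    (hqz : regularizedSupport T η₁ z = ⟪q, z⟫_ℝ - η₁ / 2 * ‖q‖ ^ 2) :
    |(relEnt (gibbs ν z) ν).toReal - dualFn ν T z| ≤
      η₁ * constD T + η₂ * ‖z‖ ^ 2 + ‖q - moments M (gibbs ν z) + η₂ • z‖ * ‖z‖ := by
  have hupper := regularizedSupport_le_add hT ⟨q, hq⟩ hη₁ (fun _ => norm_sq_le_constD hT) z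
  have hlower := inner_le_regularizedSupport_zero hT hq z
  have hq₀ : 0 ≤ η₁ / 2 * ‖q‖ ^ 2 := by positivity
  have hz₀ : 0 ≤ η₂ * ‖z‖ ^ 2 := by positivity
  have hgradient := abs_le.1 (abs_real_inner_le_norm (q - moments M (gibbs ν z) + η₂ • z) z)
  rw [inner_add_left, inner_sub_left, real_inner_smul_left, real_inner_self_eq_norm_sq]
    at hgradient
  rw [toReal_relEnt_gibbs, dualFn_eq, abs_le]
  constructor <;> linarith

theorem infDist_moments_gibbs_le (hq : q ∈ T) (hη₂ : 0 ≤ η₂) :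
    Metric.infDist (moments M (gibbs ν z)) T ≤
      η₂ * ‖z‖ + ‖q - moments M (gibbs ν z) + η₂ • z‖ :=
  calc Metric.infDist (moments M (gibbs ν z)) T ≤ dist (moments M (gibbs ν z)) q :=
        Metric.infDist_le_dist_of_mem hq
    _ = ‖η₂ • z - (q - moments M (gibbs ν z) + η₂ • z)‖ := by
      rw [dist_eq_norm]
      congr 1
      abel
    _ ≤ η₂ * ‖z‖ + ‖q - moments M (gibbs ν z) + η₂ • z‖ := by
      simpa only [norm_smul, Real.norm_of_nonneg hη₂] using
        norm_sub_le (η₂ • z) (q - moments M (gibbs ν z) + η₂ • z)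

theorem accuracy_of_small_gap [CompactSpace K] (hT : IsCompact T) (hε : 0 < ε) (hr : 0 < r)
    (hη₁ : 0 ≤ η₁) (hη₁D : η₁ * constD T = ε / 4) (hη₂ : η₂ = ε / (2 * r ^ 2)) (hp : ‖p‖ ≤ r)
    (hzp : dualFn ν T z ≤ dualFn ν T p)
    (hgap : smoothedDualFn ν T η₁ η₂ p - smoothedDualFn ν T η₁ η₂ z ≤ ε / 100) (hq : q ∈ T)
    (hqz : regularizedSupport T η₁ z = ⟪q, z⟫_ℝ - η₁ / 2 * ‖q‖ ^ 2)
    (hgrad : ‖q - moments M (gibbs ν z) + η₂ • z‖ ≤ ε / r * (2 - √3)) :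
    dualFn ν T p - dualFn ν T z ≤ ε ∧
      |(relEnt (gibbs ν z) ν).toReal - dualFn ν T p| ≤ 2 * (1 + 2 * √3) * ε ∧
      Metric.infDist (moments M (gibbs ν z)) T ≤ 2 * ε / r := by
  obtain ⟨hdual, hz⟩ :=
    dualFn_gap_and_norm_le hT ⟨q, hq⟩ hε hr hη₁ hη₁D hη₂ hp hzp hgap
  have hη₂₀ : 0 ≤ η₂ := hη₂ ▸ by positivity
  have hsqrt : 3 / 2 ≤ √3 := Real.le_sqrt_of_sq_le (by norm_num)
  have hη₂z : η₂ * ‖z‖ ≤ ε / r * (3 / 4) := calc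
    η₂ * ‖z‖ ≤ η₂ * (3 / 2 * r) := by gcongr
    _ = ε / r * (3 / 4) := by
      rw [hη₂]
      field_simp
      norm_num
  have hgrad' : ‖q - moments M (gibbs ν z) + η₂ • z‖ ≤ ε / r * (1 / 2) :=
    hgrad.trans (by gcongr; linarith)
  have hentropy := abs_relEnt_gibbs_sub_dualFn_le (ν := ν) hT hη₁ hη₂₀ hq hqz
  have hslack : (η₂ * ‖z‖ + ‖q - moments M (gibbs ν z) + η₂ • z‖) * ‖z‖ ≤ 15 / 8 * ε := calc
    _ ≤ (ε / r * (3 / 4) + ε / r * (1 / 2)) * (3 / 2 * r) := by gcongr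
    _ = 15 / 8 * ε := by
      field_simp
      norm_num
  refine ⟨hdual, ?_, ?_⟩
  · have hconst : 2 * (1 + 2 * (3 / 2)) * ε ≤ 2 * (1 + 2 * √3) * ε := by gcongr
    have := abs_sub_le (relEnt (gibbs ν z) ν).toReal (dualFn ν T z) (dualFn ν T p)
    rw [abs_sub_comm (dualFn ν T z), abs_of_nonneg (sub_nonneg.2 hzp)] at this
    linarith
  · calc Metric.infDist (moments M (gibbs ν z)) T ≤
          η₂ * ‖z‖ + ‖q - moments M (gibbs ν z) + η₂ • z‖ := infDist_moments_gibbs_le hq hη₂₀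
      _ ≤ ε / r * (3 / 4) + ε / r * (1 / 2) := add_le_add hη₂z hgrad'
      _ ≤ 2 * ε / r := by
        rw [← mul_add, mul_div_assoc, mul_comm]
        gcongr
        norm_num

end Accuracy

section FastGradient

variable {K : Set ℝ} {M : ℕ} {ν μ₀ : ProbabilityMeasure K} {T : Set (EuclideanSpace ℝ (Fin M))}
  {η₁ η₂ ε : ℝ} {y₀ : EuclideanSpace ℝ (Fin M)}
  {g : EuclideanSpace ℝ (Fin M) → EuclideanSpace ℝ (Fin M)}

theorem le_lipConst (hη₁ : 0 ≤ η₁) : η₂ ≤ lipConst K M η₁ η₂ :=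
  le_add_of_nonneg_left (by positivity)

theorem fastGradient_step {m L : ℝ}
    (hg : HasQuadraticBounds (fun z => -smoothedDualFn ν T η₁ η₂ z) g m L) (k : ℕ) :
    (fastGradient ν T η₁ η₂ y₀ (k + 1)).1 = (fastGradient ν T η₁ η₂ y₀ k).2 -
      (1 / lipConst K M η₁ η₂) • g (fastGradient ν T η₁ η₂ y₀ k).2 := by
  have hgradient := (hg.neg.hasGradientAt (fastGradient ν T η₁ η₂ y₀ k).2).gradient
  simp only [neg_neg] at hgradient
  simp only [fastGradient, hgradient, smul_neg, sub_eq_add_neg]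

theorem smoothedDualFn_sub_fastGradient_le {A B : ℝ} {k : ℕ}
    (hg : HasQuadraticBounds (fun z => -smoothedDualFn ν T η₁ η₂ z) g η₂ (lipConst K M η₁ η₂))
    (hη₁ : 0 ≤ η₁) (hη₂ : 0 < η₂)
    (hB : ∀ x, smoothedDualFn ν T η₁ η₂ x - smoothedDualFn ν T η₁ η₂ y₀ ≤ B) (hA : 0 < A)
    (hk : 2 * √(lipConst K M η₁ η₂ / η₂) * Real.log A ≤ k) (x : EuclideanSpace ℝ (Fin M)) :
    smoothedDualFn ν T η₁ η₂ x - smoothedDualFn ν T η₁ η₂ (fastGradient ν T η₁ η₂ y₀ k).1 ≤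
      2 * B / A ^ 2 := by
  obtain ⟨p, hp⟩ := hg.exists_forall_le hη₂
  have hrate := hg.fast_gradient_gap_le hη₂ (le_lipConst hη₁) hp
    (y := fun k => (fastGradient ν T η₁ η₂ y₀ k).1) (w := fun k => (fastGradient ν T η₁ η₂ y₀ k).2)
    rfl (fastGradient_step hg) (fun _ => rfl) hA hk
  calc smoothedDualFn ν T η₁ η₂ x - smoothedDualFn ν T η₁ η₂ (fastGradient ν T η₁ η₂ y₀ k).1
      ≤ 2 * (smoothedDualFn ν T η₁ η₂ p - smoothedDualFn ν T η₁ η₂ y₀) / A ^ 2 := by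
        simp only [fastGradient, neg_sub_neg] at hrate
        linarith [neg_le_neg_iff.1 (hp x)]
    _ ≤ 2 * B / A ^ 2 := by
      gcongr
      exact hB p

theorem IsSlaterPoint.smoothedDualFn_sub_le [CompactSpace K] (h : IsSlaterPoint ν T μ₀)
    (hT : IsCompact T) (hη₁ : 0 ≤ η₁) (hη₂ : 0 ≤ η₂)
    (hy₀ : smoothedDualFn ν T η₁ η₂ 0 ≤ smoothedDualFn ν T η₁ η₂ y₀)
    (x : EuclideanSpace ℝ (Fin M)) :
    smoothedDualFn ν T η₁ η₂ x - smoothedDualFn ν T η₁ η₂ y₀ ≤ constC ν μ₀ + η₁ * constD T := by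
  have hupper := smoothedDualFn_le_dualFn_sub_norm_sq (ν := ν) (η₂ := η₂) hT h.nonempty hη₁ x
  have hweak := (dualFn_le_toReal_primalValue hT h.primalValue_ne_top x).trans
    h.toReal_primalValue_le
  have hlower := dualFn_sub_norm_sq_le_smoothedDualFn (ν := ν) (η₂ := η₂) hT h.nonempty hη₁ 0
  rw [dualFn_zero hT h.nonempty, norm_zero] at hlower
  have : 0 ≤ η₂ / 2 * ‖x‖ ^ 2 := by positivity
  linarith

/-- The condition number `κ(ε) = L(η) / η₂` of the smoothed dual problem, with `η = (η₁(ε), η₂(ε))`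
and `a` standing for `‖𝒜‖`. -/
noncomputable def conditionNumber (C D δ a ε : ℝ) : ℝ :=
  8 * D * C ^ 2 / (ε ^ 2 * δ ^ 2) + 2 * a ^ 2 * C ^ 2 / (ε * δ ^ 2) + 1

variable {C D δ : ℝ}

theorem lipConst_div_eq_conditionNumber (hC : C ≠ 0) (hδ : δ ≠ 0) (hε : ε ≠ 0) :
    lipConst K M (ε / (4 * D)) (ε * δ ^ 2 / (2 * C ^ 2)) / (ε * δ ^ 2 / (2 * C ^ 2)) =
      conditionNumber C D δ (momentNorm K M) ε := by
  rw [lipConst, conditionNumber, one_div_div]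
  field_simp
  ring

theorem iter₁_le_numIter (C D δ a ε : ℝ) : iter₁ C D δ a ε ≤ numIter C D δ a ε :=
  (le_max_left _ _).trans (Nat.le_ceil _)

theorem iter₂_le_numIter (C D δ a ε : ℝ) : iter₂ C D δ a ε ≤ numIter C D δ a ε :=
  (le_max_right _ _).trans (Nat.le_ceil _)

theorem gap_bound_le (hC : 0 < C) (hε : 0 < ε) :
    2 * (C + ε / 2) / (10 * (ε + 2 * C) / ε) ^ 2 ≤ ε / 100 := by
  rw [show 2 * (C + ε / 2) / (10 * (ε + 2 * C) / ε) ^ 2 = ε / 100 * (ε / (ε + 2 * C)) by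
    field_simp; ring]
  exact mul_le_of_le_one_right (by positivity) ((div_le_one (by positivity)).2 (by linarith))

theorem gradient_bound_eq {b B L : ℝ} (hB : 0 < B) (hL : 0 < L) :
    2 * L * (2 * B / (b⁻¹ * √(4 * L * B)) ^ 2) = b ^ 2 := by
  rw [mul_pow, Real.sq_sqrt (by positivity), inv_pow]
  field_simp
  ring

theorem smoothedDualFn_sub_iterate_le
    (hg : HasQuadraticBounds (fun z => -smoothedDualFn ν T η₁ η₂ z) g η₂ (lipConst K M η₁ η₂))
    (hC : 0 < C) (hδ : 0 < δ) (hD : 0 ≤ D) (hε : 0 < ε) (hη₁ : η₁ = ε / (4 * D))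
    (hη₂ : η₂ = ε * δ ^ 2 / (2 * C ^ 2))
    (hB : ∀ x, smoothedDualFn ν T η₁ η₂ x - smoothedDualFn ν T η₁ η₂ y₀ ≤ C + ε / 2)
    (x : EuclideanSpace ℝ (Fin M)) :
    smoothedDualFn ν T η₁ η₂ x - smoothedDualFn ν T η₁ η₂
      (fastGradient ν T η₁ η₂ y₀ (numIter C D δ (momentNorm K M) ε)).1 ≤ ε / 100 := by
  have hk := iter₁_le_numIter C D δ (momentNorm K M) ε
  rw [iter₁, ← conditionNumber, ← lipConst_div_eq_conditionNumber hC.ne' hδ.ne' hε.ne', ← hη₁,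
    ← hη₂] at hk
  exact (smoothedDualFn_sub_fastGradient_le hg (hη₁ ▸ by positivity) (hη₂ ▸ by positivity) hB
    (by positivity) hk x).trans (gap_bound_le hC hε)

theorem norm_gradient_iterate_le
    (hg : HasQuadraticBounds (fun z => -smoothedDualFn ν T η₁ η₂ z) g η₂ (lipConst K M η₁ η₂))
    (hC : 0 < C) (hδ : 0 < δ) (hD : 0 ≤ D) (hε : 0 < ε) (hη₁ : η₁ = ε / (4 * D))
    (hη₂ : η₂ = ε * δ ^ 2 / (2 * C ^ 2))
    (hB : ∀ x, smoothedDualFn ν T η₁ η₂ x - smoothedDualFn ν T η₁ η₂ y₀ ≤ C + ε / 2) :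
    ‖g (fastGradient ν T η₁ η₂ y₀ (numIter C D δ (momentNorm K M) ε)).1‖ ≤
      ε / (C / δ) * (2 - √3) := by
  have hη₁₀ : 0 ≤ η₁ := hη₁ ▸ by positivity
  have hη₂₀ : 0 < η₂ := hη₂ ▸ by positivity
  have hL : 0 < lipConst K M η₁ η₂ := hη₂₀.trans_le (le_lipConst hη₁₀)
  have hsqrt : 0 < 2 - √3 := sub_pos.2 ((Real.sqrt_lt' two_pos).2 (by norm_num))
  have hk := iter₂_le_numIter C D δ (momentNorm K M) ε
  rw [iter₂, ← conditionNumber, ← lipConst_div_eq_conditionNumber hC.ne' hδ.ne' hε.ne',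
    ← one_div_div ε, ← hη₁, ← hη₂, ← lipConst,
    show C / (ε * δ * (2 - √3)) = (ε / (C / δ) * (2 - √3))⁻¹ by field_simp] at hk
  have hsq := hg.norm_gradient_sq_le hL fun v => by
    simpa only [neg_sub_neg] using
      smoothedDualFn_sub_fastGradient_le hg hη₁₀ hη₂₀ hB (by positivity) hk v
  rw [gradient_bound_eq (by positivity) hL] at hsq
  exact (sq_le_sq₀ (norm_nonneg _) (by positivity)).1 hsq

end FastGradient

section Asymptotics

variable {C D δ ε : ℝ}

theorem isBigO_natCeil {α : Type*} {l : Filter α} {f g : α → ℝ} {c : ℝ}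
    (hg : ∀ᶠ x in l, 1 ≤ g x) (hfg : ∀ᶠ x in l, f x ≤ c * g x) :
    (fun x => (⌈f x⌉₊ : ℝ)) =O[l] g := by
  refine IsBigO.of_bound (|c| + 1) ?_
  filter_upwards [hg, hfg] with x hg hfg
  have hg₀ : 0 ≤ g x := zero_le_one.trans hg
  rw [Real.norm_of_nonneg (Nat.cast_nonneg _), Real.norm_of_nonneg hg₀]
  calc (⌈f x⌉₊ : ℝ) ≤ ⌈|c| * g x⌉₊ := by
        gcongr
        exact hfg.trans (by gcongr; exact le_abs_self c)
    _ ≤ |c| * g x + 1 := (Nat.ceil_lt_add_one (by positivity)).le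
    _ ≤ (|c| + 1) * g x := by linarith

theorem tendsto_log_one_div_nhdsGT_zero :
    Tendsto (fun ε : ℝ => Real.log (1 / ε)) (𝓝[>] 0) atTop := by
  simp only [one_div]
  exact Real.tendsto_log_atTop.comp tendsto_inv_nhdsGT_zero

theorem eventually_log_le {A : ℝ → ℝ} {b : ℝ} {n : ℕ} (hb : 0 < b)
    (hA : ∀ ε ∈ Set.Ioc (0 : ℝ) 1, 0 < A ε ∧ A ε ≤ b * (1 / ε) ^ n) :
    ∀ᶠ ε in 𝓝[>] 0, Real.log (A ε) ≤ (n + 1) * Real.log (1 / ε) := by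
  filter_upwards [Ioc_mem_nhdsGT one_pos,
    tendsto_log_one_div_nhdsGT_zero.eventually_ge_atTop (Real.log b)] with ε hε hlogb
  have hε₀ : 0 < 1 / ε := one_div_pos.2 hε.1
  have := Real.log_le_log (hA ε hε).1 (hA ε hε).2
  rw [Real.log_mul hb.ne' (by positivity), Real.log_pow] at this
  linarith

theorem sqrt_conditionNumber_le (hD : 0 ≤ D) (a : ℝ) (hε : ε ∈ Set.Ioc (0 : ℝ) 1) :
    √(conditionNumber C D δ a ε) ≤ √(conditionNumber C D δ a 1) * ε⁻¹ := by
  obtain ⟨hε₀, hε₁⟩ := hε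
  have hinv : 1 ≤ ε⁻¹ := (one_le_inv₀ hε₀).2 hε₁
  have hnonneg : 0 ≤ conditionNumber C D δ a 1 := by
    unfold conditionNumber
    positivity
  rw [Real.sqrt_le_left (by positivity), mul_pow, Real.sq_sqrt hnonneg]
  calc conditionNumber C D δ a ε = 8 * D * C ^ 2 / (1 ^ 2 * δ ^ 2) * ε⁻¹ ^ 2 +
        2 * a ^ 2 * C ^ 2 / (1 * δ ^ 2) * ε⁻¹ + 1 := by
        unfold conditionNumber
        field_simp
    _ ≤ 8 * D * C ^ 2 / (1 ^ 2 * δ ^ 2) * ε⁻¹ ^ 2 +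
        2 * a ^ 2 * C ^ 2 / (1 * δ ^ 2) * ε⁻¹ ^ 2 + ε⁻¹ ^ 2 := by
        gcongr
        · exact le_self_pow₀ hinv two_ne_zero
        · exact one_le_pow₀ hinv
    _ = conditionNumber C D δ a 1 * ε⁻¹ ^ 2 := by
        unfold conditionNumber
        ring

theorem sqrt_lipschitz_mul_gap_le (hC : 0 ≤ C) (hD : 0 ≤ D) (δ a : ℝ)
    (hε : ε ∈ Set.Ioc (0 : ℝ) 1) :
    √(4 * (4 * D / ε + a ^ 2 + ε * δ ^ 2 / (2 * C ^ 2)) * (C + ε / 2)) ≤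
      √(4 * (4 * D + a ^ 2 + δ ^ 2 / (2 * C ^ 2)) * (C + 1 / 2)) * ε⁻¹ := by
  obtain ⟨hε₀, hε₁⟩ := hε
  have hinv : 1 ≤ ε⁻¹ := (one_le_inv₀ hε₀).2 hε₁
  rw [Real.sqrt_le_left (by positivity), mul_pow, Real.sq_sqrt (by positivity)]
  calc 4 * (4 * D / ε + a ^ 2 + ε * δ ^ 2 / (2 * C ^ 2)) * (C + ε / 2) ≤
        4 * (4 * D * ε⁻¹ ^ 2 + a ^ 2 * ε⁻¹ ^ 2 + ε⁻¹ ^ 2 * δ ^ 2 / (2 * C ^ 2)) * (C + 1 / 2) := by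
        rw [div_eq_mul_inv (4 * D)]
        have hsq : 1 ≤ ε⁻¹ ^ 2 := one_le_pow₀ hinv
        gcongr
        · exact le_self_pow₀ hinv two_ne_zero
        · exact le_mul_of_one_le_right (sq_nonneg a) hsq
        · exact hε₁.trans hsq
    _ = 4 * (4 * D + a ^ 2 + δ ^ 2 / (2 * C ^ 2)) * (C + 1 / 2) * ε⁻¹ ^ 2 := by ring

theorem eventually_log_iter₁_arg_le (hC : 0 ≤ C) :
    ∀ᶠ ε in 𝓝[>] 0, Real.log (10 * (ε + 2 * C) / ε) ≤ 3 * Real.log (1 / ε) := by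
  have hlog := eventually_log_le (A := fun ε => 10 * (ε + 2 * C) / ε) (b := 10 * (1 + 2 * C))
    (n := 1) (by positivity) fun ε ⟨hε₀, hε₁⟩ =>
      ⟨by positivity, by rw [pow_one, mul_one_div]; gcongr⟩
  filter_upwards [hlog, tendsto_log_one_div_nhdsGT_zero.eventually_ge_atTop 0] with ε hle hlog₀
  push_cast at hle
  linarith

theorem eventually_log_iter₂_arg_le (hC : 0 < C) (hD : 0 ≤ D) (hδ : 0 < δ) (a : ℝ) :
    ∀ᶠ ε in 𝓝[>] 0, Real.log (C / (ε * δ * (2 - √3)) *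
      √(4 * (4 * D / ε + a ^ 2 + ε * δ ^ 2 / (2 * C ^ 2)) * (C + ε / 2))) ≤
        3 * Real.log (1 / ε) := by
  have hsqrt : 0 < 2 - √3 := sub_pos.2 ((Real.sqrt_lt' two_pos).2 (by norm_num))
  have hlog := eventually_log_le (n := 2)
    (A := fun ε => C / (ε * δ * (2 - √3)) *
      √(4 * (4 * D / ε + a ^ 2 + ε * δ ^ 2 / (2 * C ^ 2)) * (C + ε / 2)))
    (b := C / (δ * (2 - √3)) * √(4 * (4 * D + a ^ 2 + δ ^ 2 / (2 * C ^ 2)) * (C + 1 / 2)))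
    (by positivity) fun ε hε => by
      have hε₀ := hε.1
      refine ⟨by positivity, ?_⟩
      calc _ ≤ C / (ε * δ * (2 - √3)) *
            (√(4 * (4 * D + a ^ 2 + δ ^ 2 / (2 * C ^ 2)) * (C + 1 / 2)) * ε⁻¹) := by
            gcongr
            exact sqrt_lipschitz_mul_gap_le hC.le hD δ a hε
        _ = _ := by field_simp
  filter_upwards [hlog] with ε hle
  norm_num at hle ⊢
  exact hle

theorem numIter_isBigO (hC : 0 < C) (hD : 0 ≤ D) (hδ : 0 < δ) (a : ℝ) :
    (fun ε : ℝ => (numIter C D δ a ε : ℝ)) =O[𝓝[>] 0] fun ε : ℝ => ε⁻¹ * Real.log (1 / ε) := by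
  refine isBigO_natCeil (c := 6 * √(conditionNumber C D δ a 1)) ?_ ?_
  · filter_upwards [Ioc_mem_nhdsGT one_pos,
      tendsto_log_one_div_nhdsGT_zero.eventually_ge_atTop 1] with ε ⟨hε₀, hε₁⟩ hlog
    exact one_le_mul_of_one_le_of_one_le ((one_le_inv₀ hε₀).2 hε₁) hlog
  · filter_upwards [Ioc_mem_nhdsGT one_pos,
      tendsto_log_one_div_nhdsGT_zero.eventually_ge_atTop 0, eventually_log_iter₁_arg_le hC.le,
      eventually_log_iter₂_arg_le hC hD hδ a] with ε hε hlog hlog₁ hlog₂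
    have hbound : 2 * √(conditionNumber C D δ a ε) * (3 * Real.log (1 / ε)) ≤
        6 * √(conditionNumber C D δ a 1) * (ε⁻¹ * Real.log (1 / ε)) := calc
      _ ≤ 2 * (√(conditionNumber C D δ a 1) * ε⁻¹) * (3 * Real.log (1 / ε)) := by
        gcongr
        exact sqrt_conditionNumber_le hD a hε
      _ = _ := by ring
    exact max_le ((mul_le_mul_of_nonneg_left hlog₁ (by positivity)).trans hbound)
      ((mul_le_mul_of_nonneg_left hlog₂ (by positivity)).trans hbound)

end Asymptotics

section Convergence

variable {K : Set ℝ} {M : ℕ} {ν μ₀ : ProbabilityMeasure K} {T : Set (EuclideanSpace ℝ (Fin M))}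

theorem IsSlaterPoint.accuracy_fastGradient [CompactSpace K] (h : IsSlaterPoint ν T μ₀)
    (hne : μ₀ ≠ ν) (hT : IsCompact T) (hconv : Convex ℝ T) {C δ D ε η₁ η₂ : ℝ}
    (hC : C = constC ν μ₀) (hδ : δ = constδ T μ₀) (hD : D = constD T) (hε : 0 < ε)
    (hη₁ : η₁ = ε / (4 * D)) (hη₂ : η₂ = ε * δ ^ 2 / (2 * C ^ 2))
    {y₀ z : EuclideanSpace ℝ (Fin M)}
    (hy₀ : smoothedDualFn ν T η₁ η₂ 0 ≤ smoothedDualFn ν T η₁ η₂ y₀)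
    (hz : z = (fastGradient ν T η₁ η₂ y₀ (numIter C D δ (momentNorm K M) ε)).1) :
    (primalValue ν T).toReal - dualFn ν T z ≤ ε ∧
      |(relEnt (gibbs ν z) ν).toReal - (primalValue ν T).toReal| ≤ 2 * (1 + 2 * √3) * ε ∧
      Metric.infDist (moments M (gibbs ν z)) T ≤ 2 * ε * δ / C := by
  have hCpos : 0 < C := hC ▸ h.constC_pos hne
  have hδpos : 0 < δ := hδ ▸ h.constδ_pos
  have hDpos : 0 < D := hD ▸ constD_pos hT h.constδ_pos h.moments_mem
  have hη₁pos : 0 < η₁ := hη₁ ▸ by positivity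
  have hη₁D : η₁ * constD T = ε / 4 := by
    rw [hη₁, ← hD]
    field_simp
  have hη₂r : η₂ = ε / (2 * (C / δ) ^ 2) := by
    rw [hη₂]
    field_simp
  choose q hqT hq using exists_regularizedSupport_eq hT h.nonempty η₁
  have hg := hasQuadraticBounds_neg_smoothedDualFn (ν := ν) hT hconv hη₁pos η₂ hqT hq
  have hB (x) : smoothedDualFn ν T η₁ η₂ x - smoothedDualFn ν T η₁ η₂ y₀ ≤ C + ε / 2 := by
    linarith [h.smoothedDualFn_sub_le hT hη₁pos.le (hη₂ ▸ by positivity) hy₀ x]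
  obtain ⟨p, hp, hpC⟩ := h.exists_dualFn_eq_primalValue hT hconv
  have hpr : ‖p‖ ≤ C / δ := (le_div_iff₀' hδpos).2 (by rwa [hC, hδ])
  have hgap := smoothedDualFn_sub_iterate_le hg hCpos hδpos hDpos.le hε hη₁ hη₂ hB p
  have hgrad := norm_gradient_iterate_le hg hCpos hδpos hDpos.le hε hη₁ hη₂ hB
  rw [← hz] at hgap hgrad
  rw [← hp, show 2 * ε * δ / C = 2 * ε / (C / δ) by field_simp]
  exact accuracy_of_small_gap hT hε (div_pos hCpos hδpos) hη₁pos.le hη₁D hη₂r hpr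
    (hp ▸ dualFn_le_toReal_primalValue hT h.primalValue_ne_top z) hgap (hqT z) (hq z) hgrad

end Convergence

end MaxEnt

open MaxEnt in
theorem mainTheorem12_general {K : Set ℝ} {M : ℕ} {ν μ₀ : ProbabilityMeasure K}
    {T : Set (EuclideanSpace ℝ (Fin M))} (hK : IsCompact K) (hT : IsCompact T)
    (hconv : Convex ℝ T) (h : IsSlaterPoint ν T μ₀) (hne : μ₀ ≠ ν) {C δ D a : ℝ}
    (hC : C = constC ν μ₀) (hδ : δ = constδ T μ₀) (hD : D = constD T) (ha : a = momentNorm K M) :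
    (∀ ε : ℝ, 0 < ε →
      ∀ η₁ η₂ : ℝ, η₁ = ε / (4 * D) → η₂ = ε * δ ^ 2 / (2 * C ^ 2) →
      ∀ y₀ : EuclideanSpace ℝ (Fin M),
        smoothedDualFn ν T η₁ η₂ 0 ≤ smoothedDualFn ν T η₁ η₂ y₀ →
      ∀ z : EuclideanSpace ℝ (Fin M), z = (fastGradient ν T η₁ η₂ y₀ (numIter C D δ a ε)).1 →
        (0 ≤ (primalValue ν T).toReal - dualFn ν T z ∧
          (primalValue ν T).toReal - dualFn ν T z ≤ ε) ∧
        IsProbabilityMeasure (gibbs ν z) ∧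
        relEnt (gibbs ν z) ν ≠ ∞ ∧
        |(relEnt (gibbs ν z) ν).toReal - (primalValue ν T).toReal| ≤ 2 * (1 + 2 * √3) * ε ∧
        Metric.infDist (moments M (gibbs ν z)) T ≤ 2 * ε * δ / C) ∧
    (fun ε : ℝ => (numIter C D δ a ε : ℝ)) =O[𝓝[>] 0] fun ε : ℝ => ε⁻¹ * Real.log (1 / ε) := by
  have : CompactSpace K := isCompact_iff_compactSpace.1 hK
  refine ⟨fun ε hε η₁ η₂ hη₁ hη₂ y₀ hy₀ z hz => ?_, numIter_isBigO (hC ▸ h.constC_pos hne)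
    (hD ▸ constD_pos hT h.constδ_pos h.moments_mem).le (hδ ▸ h.constδ_pos) a⟩
  obtain ⟨hdual, hprimal, hfeasible⟩ :=
    h.accuracy_fastGradient hne hT hconv hC hδ hD hε hη₁ hη₂ hy₀ (ha ▸ hz)
  exact ⟨⟨sub_nonneg.2 (dualFn_le_toReal_primalValue hT h.primalValue_ne_top z), hdual⟩,
    isProbabilityMeasure_gibbs ν z, relEnt_gibbs_ne_top ν z, hprimal, hfeasible⟩

open MaxEnt in
theorem mainTheorem12 {K : Set ℝ} (hK : IsCompact K) (ν : ProbabilityMeasure K) {M : ℕ}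
    (y : Fin M → ℝ) (U : Fin M → Set ℝ)
    (hUcompact : ∀ i, IsCompact (U i)) (hUconvex : ∀ i, Convex ℝ (U i)) (hU0 : ∀ i, 0 ∈ U i)
    (T : Set (EuclideanSpace ℝ (Fin M))) (hT : T = constraintSet y U)
    (μ₀ : ProbabilityMeasure K)
    (hfeas : moments M (μ₀ : Measure K) ∈ T)
    (C δ D a : ℝ) (hC : C = constC ν μ₀) (hδ : δ = constδ T μ₀) (hD : D = constD T)
    (ha : a = momentNorm K M)
    (hδpos : 0 < δ)
    (hfin : relEnt (μ₀ : Measure K) ν ≠ ∞) (hne : μ₀ ≠ ν) :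
    (∀ ε : ℝ, 0 < ε →
      ∀ η₁ η₂ : ℝ, η₁ = ε / (4 * D) → η₂ = ε * δ ^ 2 / (2 * C ^ 2) →
      ∀ y₀ : EuclideanSpace ℝ (Fin M),
        smoothedDualFn ν T η₁ η₂ 0 ≤ smoothedDualFn ν T η₁ η₂ y₀ →
      ∀ z : EuclideanSpace ℝ (Fin M), z = (fastGradient ν T η₁ η₂ y₀ (numIter C D δ a ε)).1 →
        (0 ≤ (primalValue ν T).toReal - dualFn ν T z ∧
          (primalValue ν T).toReal - dualFn ν T z ≤ ε) ∧
        IsProbabilityMeasure (gibbs ν z) ∧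
        relEnt (gibbs ν z) ν ≠ ∞ ∧
        |(relEnt (gibbs ν z) ν).toReal - (primalValue ν T).toReal| ≤ 2 * (1 + 2 * √3) * ε ∧
        Metric.infDist (moments M (gibbs ν z)) T ≤ 2 * ε * δ / C) ∧
    (fun ε : ℝ => (numIter C D δ a ε : ℝ)) =O[𝓝[>] 0] fun ε : ℝ => ε⁻¹ * Real.log (1 / ε) :=
  mainTheorem12_general hK (hT ▸ isCompact_constraintSet hUcompact)
    (hT ▸ convex_constraintSet hUconvex) ⟨hfin, hδ ▸ hδpos⟩ hne hC hδ hD ha
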